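/- Let $p\in\mathbb N$, let $B\in M_p(\mathbb Z)$ with $r:=|\det B|>1$, and put $A=(B^T)^{-1}$ and $\langle x,y\rangle=\exp(2\pi i\sum_{a} x^ay^a)$ for $x,y\in\mathbb R^p$. For $n\ge 0$ let $\mathbb T_n=\mathbb R^p/B^n\mathbb Z^p$, and let $r^{-n}dm$ be its Haar measure normalized to total mass $1$. Let $\mathbb Z_B=\mathbb Z^p/B\mathbb Z^p$, with dual group $\widehat{\mathbb Z_B}=A\mathbb Z^p/\mathbb Z^p$, which has $r$ elements, and index the standard basis of $\mathbb C^r$ by $\widehat{\mathbb Z_B}$. Let $s(k)\in A\mathbb Z^p\cap[0,1)^p$ be the representative of $k\in\widehat{\mathbb Z_B}$, and $s_h(k)=A^{h-1}s(k)\in A^h\mathbb Z^p\cap A^{h-1}[0,1)^p$ for $h\ge1$. For $h\ge 1$, $\mathbb Z_B$ is identified with the subgroup $B^{h-1}\mathbb Z^p/B^h\mathbb Z^p$ of $\mathbb T_h$ through $g\mapsto B^{h-1}g$. For $\xi\in L^2(\mathbb T_h,r^{-h}dm)$ and $k\in\widehat{\mathbb Z_B}$ let $$E_k(\xi)(t)=\frac1r\sum_{g\in\mathbb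 Z_B}\langle -k,g\rangle\,\xi(t-g),\qquad \sigma_h(k)(t)=\overline{\langle s_h(k),t\rangle},\qquad t\in\mathbb T_h .$$ Then $\sigma_h(k)^{-1}E_k(\xi)$ is $B^{h-1}\mathbb Z^p$-periodic, that is, a function on $\mathbb T_{h-1}$; let $$v_h: L^2(\mathbb T_h,r^{-h}dm)\to L^2(\mathbb T_{h-1},r^{-(h-1)}dm)\otimes\mathbb C^r,\qquad v_h\xi=\big(\sigma_h(k)^{-1}E_k(\xi)\big)_{k\in\widehat{\mathbb Z_B}} .$$ Let $\varepsilon^1,\dots,\varepsilon^p\in M_{2^{[p/2]}}(\mathbb C)$ be self-adjoint matrices with $\varepsilon^a\varepsilon^b+\varepsilon^b\varepsilon^a=2\delta_{ab}I$, and let $D_n=-i\sum_{a=1}^p\varepsilon^a\otimes\partial^a$ be the Dirac operator on $\mathbb C^{2^{[p/2]}}\otimes L^2(\mathbb T_n,r^{-n}dm)$, where $\partial^a$ is the weak partial derivative and the domain of $D_n$ is $\mathbb C^{2^{[p/2]}}\otimes H^1(\mathbb T_n)$. Theorem. For every $n\ge0$ the operator $$V_n=I\otimes\big[(v_1\otimes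 I^{\otimes n-1})\circ(v_2\otimes I^{\otimes n-2})\circ\cdots\circ v_n\big]:\ \mathbb C^{2^{[p/2]}}\otimes L^2(\mathbb T_n,r^{-n}dm)\to\mathbb C^{2^{[p/2]}}\otimes L^2(\mathbb T_0,dm)\otimes(\mathbb C^r)^{\otimes n}$$ is unitary, and, as an equality of unbounded operators (including domains), $$\widehat D_n:=V_nD_nV_n^*=D_0\otimes I-2\pi\sum_{a=1}^p\varepsilon^a\otimes I\otimes\Big(\sum_{h=1}^nI^{\otimes h-1}\otimes\mathrm{diag}(s_h(\cdot)^a)\otimes I^{\otimes n-h}\Big),$$ where $\mathrm{diag}(s_h(\cdot)^a)_{j,k}=\delta_{j,k}\,s_h(k)^a$ for $j,k\in\widehat{\mathbb Z_B}$. Moreover $$\big(C^1(\mathbb T_n),\ \mathbb C^{2^{[p/2]}}\otimes L^2(\mathbb T_0,dm)\otimes(\mathbb C^r)^{\otimes n},\ \widehat D_n\big)$$ is a spectral triple over the C*-algebra $C(\mathbb T_n)$, acting by $f\mapsto V_n(I\otimes f)V_n^*$: this is a faithful $*$-representation, $C^1(\mathbb T_n)$ is a dense $*$-subalgebra of $C(\mathbb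 T_n)$, $\widehat D_n$ is densely defined and self-adjoint with compact resolvent, and for $f\in C^1(\mathbb T_n)$ the operator $V_n(I\otimes f)V_n^*$ preserves the domain of $\widehat D_n$ and has bounded commutator with $\widehat D_n$ there. -/

import Mathlib

open MeasureTheory
open scoped ENNReal ContDiff

noncomputable section

namespace TorusCover

/-! ### Hilbert spaces, tensor products with finite-dimensional spaces, unbounded operators -/

section Hilbert

variable {K : Type*} [NormedAddCommGroup K] [InnerProductSpace ℂ K]
variable {K' : Type*} [NormedAddCommGroup K'] [InnerProductSpace ℂ K']

/-- The Hilbert space `K ⊗ ℂ^J` for a finite index set `J`, as the Hilbert sum of copies of `K`: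
the family `(η_j)` stands for `∑ j, η_j ⊗ e_j`. -/
abbrev Amp (J : Type*) [Fintype J] (K : Type*) [NormedAddCommGroup K]
    [InnerProductSpace ℂ K] : Type _ :=
  PiLp 2 (fun _ : J => K)

/-- The operator `K → K' ⊗ ℂ^J` with components `T j`. -/
def tuple {J : Type*} [Fintype J] (T : J → (K →L[ℂ] K')) : K →L[ℂ] Amp J K' :=
  ((PiLp.continuousLinearEquiv 2 ℂ (fun _ : J => K')).symm :
    (J → K') →L[ℂ] Amp J K').comp (ContinuousLinearMap.pi T)

/-- The `j`-th component `K ⊗ ℂ^J → K`. -/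
def component {J : Type*} [Fintype J] (j : J) : Amp J K →L[ℂ] K :=
  PiLp.proj 2 (fun _ : J => K) j

/-- The operator `S ⊗ M` from `K ⊗ ℂ^J` to `K' ⊗ ℂ^J`, with `M` a complex matrix. -/
def opTensor {J : Type*} [Fintype J] (S : K →L[ℂ] K') (M : Matrix J J ℂ) :
    Amp J K →L[ℂ] Amp J K' :=
  tuple fun j => ∑ k, M j k • S.comp (component k)

/-- The operator `D ⊗ I` on `K ⊗ ℂ^J` for an unbounded operator `D` on `K`; its domain consists
of the families with all components in the domain of `D`. -/
def amplify (J : Type*) [Fintype J] (D : K →ₗ.[ℂ] K) : Amp J K →ₗ.[ℂ] Amp J K where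
  domain :=
    { carrier := {η | ∀ j, η j ∈ D.domain}
      add_mem' := fun h₁ h₂ j => D.domain.add_mem (h₁ j) (h₂ j)
      zero_mem' := fun _ => D.domain.zero_mem
      smul_mem' := fun c _ h j => D.domain.smul_mem c (h j) }
  toFun :=
    { toFun := fun η => WithLp.toLp 2 fun j => D ⟨η.1 j, η.2 j⟩
      map_add' := fun η₁ η₂ => by
        ext j
        exact D.map_add ⟨η₁.1 j, η₁.2 j⟩ ⟨η₂.1 j, η₂.2 j⟩
      map_smul' := fun c η => by
        ext j
        exact D.map_smul c ⟨η.1 j, η.2 j⟩ }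

/-- The tensor product `⨂ h, M h` of `n` matrices, on `(ℂ^J)^{⊗ n}`, whose basis is indexed by the
multi-indices `Fin n → J`. -/
def tensorMatrix {n : ℕ} {J : Type*} (M : Fin n → Matrix J J ℂ) :
    Matrix (Fin n → J) (Fin n → J) ℂ :=
  fun j k => ∏ h, M h (j h) (k h)

/-- The matrix `I^{⊗ h-1} ⊗ M ⊗ I^{⊗ n-h}` with `M` in position `h`. -/
def inSlot {n : ℕ} {J : Type*} [DecidableEq J] (h : Fin n) (M : Matrix J J ℂ) :
    Matrix (Fin n → J) (Fin n → J) ℂ :=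
  tensorMatrix (Function.update (fun _ => 1) h M)

/-- The unbounded operator `V D V*`, with domain `{η | V* η ∈ dom D}`. -/
def conjOp [CompleteSpace K] [CompleteSpace K'] (V : K →L[ℂ] K') (D : K →ₗ.[ℂ] K) :
    K' →ₗ.[ℂ] K' where
  domain := D.domain.comap (ContinuousLinearMap.adjoint V : K' →ₗ[ℂ] K)
  toFun :=
    { toFun := fun η => V (D ⟨ContinuousLinearMap.adjoint V η.1, η.2⟩)
      map_add' := fun η₁ η₂ => by
        rw [← map_add, ← D.map_add]
        congr 2
        exact Subtype.ext (map_add _ η₁.1 η₂.1)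
      map_smul' := fun c η => by
        rw [RingHom.id_apply, ← map_smul, ← D.map_smul]
        congr 2
        exact Subtype.ext (map_smul _ c η.1) }

/-- `D` has compact resolvent: for every non-real `z`, the operator `D - z` is a bijection from
`dom D` onto the Hilbert space, whose inverse is (bounded and) compact. -/
def HasCompactResolvent (D : K →ₗ.[ℂ] K) : Prop :=
  ∀ z : ℂ, z.im ≠ 0 → ∃ R : K →L[ℂ] K, IsCompactOperator R ∧
    (∀ ξ : K, ∃ h : R ξ ∈ D.domain, D ⟨R ξ, h⟩ - z • R ξ = ξ) ∧
    (∀ ξ : D.domain, R (D ξ - z • (ξ : K)) = ξ)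

/-- `(L, K, D)` is a spectral triple over the unital C*-algebra `A`, which acts on the Hilbert space
`K` through the faithful unital representation `π`: `L` is a dense *-subalgebra of `A`, `D` is a
(densely defined) self-adjoint operator with compact resolvent, and for `a ∈ L` the operator `π a`
preserves the domain of `D` and the commutator `[D, π a]` is bounded. -/
structure IsSpectralTriple [CompleteSpace K] {A : Type*} [CStarAlgebra A]
    (π : A →⋆ₐ[ℂ] (K →L[ℂ] K)) (L : StarSubalgebra ℂ A) (D : K →ₗ.[ℂ] K) : Prop where
  faithful : Function.Injective π
  dense : Dense (L : Set A)
  dense_domain : Dense (D.domain : Set K)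
  selfAdjoint : IsSelfAdjoint D
  compact_resolvent : HasCompactResolvent D
  bounded_commutator : ∀ a ∈ L, ∃ C : ℝ, ∀ ξ : D.domain,
    ∃ h : π a ξ ∈ D.domain, ‖D ⟨π a ξ, h⟩ - π a (D ξ)‖ ≤ C * ‖(ξ : K)‖

end Hilbert

/-! ### Lattices -/

section Lattice

variable {p : ℕ}

/-- `ℤ^p` as a subgroup of `ℝ^p`. -/
def intLattice (p : ℕ) : AddSubgroup (Fin p → ℝ) :=
  (AddMonoidHom.pi fun a => (Int.castAddHom ℝ).comp (Pi.evalAddMonoidHom (fun _ => ℤ) a)).range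

/-- `M ℤ^p` as a subgroup of `ℝ^p`. -/
def imgLattice (M : Matrix (Fin p) (Fin p) ℝ) : AddSubgroup (Fin p → ℝ) :=
  (intLattice p).map M.mulVecLin.toAddMonoidHom

/-- `B` as a real matrix. -/
def realMat (B : Matrix (Fin p) (Fin p) ℤ) : Matrix (Fin p) (Fin p) ℝ :=
  B.map (fun z : ℤ => (z : ℝ))

/-- `A = (Bᵀ)⁻¹`. -/
def dualMat (B : Matrix (Fin p) (Fin p) ℤ) : Matrix (Fin p) (Fin p) ℝ :=
  (realMat B).transpose⁻¹

lemma mem_intLattice {x : Fin p → ℝ} :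
    x ∈ intLattice p ↔ ∃ z : Fin p → ℤ, x = fun a => (z a : ℝ) := by
  constructor
  · rintro ⟨z, rfl⟩
    exact ⟨z, rfl⟩
  · rintro ⟨z, rfl⟩
    exact ⟨z, rfl⟩

lemma mem_imgLattice {M : Matrix (Fin p) (Fin p) ℝ} {x : Fin p → ℝ} :
    x ∈ imgLattice M ↔ ∃ z : Fin p → ℤ, x = M.mulVec (fun a => (z a : ℝ)) := by
  constructor
  · rintro ⟨y, hy, rfl⟩
    obtain ⟨z, rfl⟩ := mem_intLattice.1 hy
    exact ⟨z, rfl⟩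
  · rintro ⟨z, rfl⟩
    exact ⟨_, mem_intLattice.2 ⟨z, rfl⟩, rfl⟩

lemma realMat_mulVec (B : Matrix (Fin p) (Fin p) ℤ) (z : Fin p → ℤ) :
    (realMat B).mulVec (fun a => (z a : ℝ)) = fun a => ((B.mulVec z a : ℤ) : ℝ) := by
  ext a
  simp [realMat, Matrix.mulVec, dotProduct]

variable (B : Matrix (Fin p) (Fin p) ℤ)

/-- `B^n ℤ^p`. -/
def coverLattice (n : ℕ) : AddSubgroup (Fin p → ℝ) := imgLattice (realMat B ^ n)

/-- `A^n ℤ^p`. -/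
def dualLattice (n : ℕ) : AddSubgroup (Fin p → ℝ) := imgLattice (dualMat B ^ n)

lemma coverLattice_succ_le (n : ℕ) : coverLattice B (n + 1) ≤ coverLattice B n := by
  intro x hx
  obtain ⟨z, rfl⟩ := mem_imgLattice.1 hx
  refine mem_imgLattice.2 ⟨B.mulVec z, ?_⟩
  rw [pow_succ, ← Matrix.mulVec_mulVec, realMat_mulVec]

variable [hB : Fact (1 < |B.det|)]

lemma isUnit_det_realMat : IsUnit (realMat B).det := by
  have h : (realMat B).det = (B.det : ℝ) := by
    simpa [realMat] using (Int.cast_det (R := ℝ) B).symm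
  rw [h, isUnit_iff_ne_zero]
  have : B.det ≠ 0 := by
    intro h0
    have := hB.out
    simp [h0] at this
  exact_mod_cast this


lemma isUnit_realMat : IsUnit (realMat B) :=
  (Matrix.isUnit_iff_isUnit_det _).2 (isUnit_det_realMat B)

/-- The duality `A^n u · B^n w = u · w`. -/
lemma dual_pow_dotProduct (n : ℕ) (u w : Fin p → ℝ) :
    dotProduct ((dualMat B ^ n).mulVec u) ((realMat B ^ n).mulVec w) = dotProduct u w := by
  have h : (dualMat B ^ n).transpose * realMat B ^ n = 1 := by
    rw [Matrix.transpose_pow, dualMat, Matrix.transpose_nonsing_inv, Matrix.transpose_transpose,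
      Matrix.inv_pow', Matrix.nonsing_inv_mul]
    rw [Matrix.det_pow]
    exact (isUnit_det_realMat B).pow n
  rw [Matrix.dotProduct_mulVec, Matrix.vecMul_mulVec, ← Matrix.dotProduct_mulVec, h,
    Matrix.one_mulVec]

lemma intLattice_le_dualLattice_one : intLattice p ≤ dualLattice B 1 := by
  intro x hx
  obtain ⟨z, rfl⟩ := mem_intLattice.1 hx
  refine mem_imgLattice.2 ⟨B.transpose.mulVec z, ?_⟩
  have h : (fun a => ((B.transpose.mulVec z a : ℤ) : ℝ))
      = (realMat B).transpose.mulVec (fun a => (z a : ℝ)) := by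
    rw [← realMat_mulVec]
    rfl
  have hu : IsUnit (realMat B).transpose.det := by
    rw [Matrix.det_transpose]
    exact isUnit_det_realMat B
  rw [h, pow_one, Matrix.mulVec_mulVec, dualMat, Matrix.nonsing_inv_mul _ hu, Matrix.one_mulVec]

end Lattice

/-! ### The covering tori -/

section Torus

variable {p : ℕ} (B : Matrix (Fin p) (Fin p) ℤ)

/-- The torus `T_n = ℝ^p / B^n ℤ^p`. -/
def Torus (n : ℕ) : Type := (Fin p → ℝ) ⧸ coverLattice B n

instance (n : ℕ) : AddCommGroup (Torus B n) :=
  inferInstanceAs (AddCommGroup ((Fin p → ℝ) ⧸ coverLattice B n))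

instance (n : ℕ) : TopologicalSpace (Torus B n) :=
  inferInstanceAs (TopologicalSpace ((Fin p → ℝ) ⧸ coverLattice B n))

instance (n : ℕ) : IsTopologicalAddGroup (Torus B n) :=
  inferInstanceAs (IsTopologicalAddGroup ((Fin p → ℝ) ⧸ coverLattice B n))

instance (n : ℕ) : MeasurableSpace (Torus B n) := borel _

instance (n : ℕ) : BorelSpace (Torus B n) := ⟨rfl⟩

/-- The quotient map `ℝ^p → T_n`. -/
def toTorus (n : ℕ) : (Fin p → ℝ) →+ Torus B n := QuotientAddGroup.mk' (coverLattice B n)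

lemma continuous_toTorus (n : ℕ) : Continuous (toTorus B n) := continuous_quotient_mk'

lemma toTorus_surjective (n : ℕ) : Function.Surjective (toTorus B n) :=
  QuotientAddGroup.mk'_surjective _

lemma toTorus_eq_zero {n : ℕ} {x : Fin p → ℝ} : toTorus B n x = 0 ↔ x ∈ coverLattice B n :=
  QuotientAddGroup.eq_zero_iff x

instance [hB : Fact (1 < |B.det|)] (n : ℕ) : CompactSpace (Torus B n) := by
  let f : (Fin p → ℝ) → Torus B n := fun x => toTorus B n ((realMat B ^ n).mulVec x)
  have hf : Continuous f := (continuous_toTorus B n).comp (by fun_prop)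
  have hs : f '' Set.Icc 0 1 = Set.univ := by
    refine Set.eq_univ_of_forall fun y => ?_
    obtain ⟨y, rfl⟩ := toTorus_surjective B n y
    obtain ⟨x, rfl⟩ : ∃ x, (realMat B ^ n).mulVec x = y :=
      (Matrix.mulVec_surjective_iff_isUnit.2 ((isUnit_realMat B).pow n)) y
    refine ⟨fun a => Int.fract (x a), ⟨fun a => Int.fract_nonneg _, fun a =>
      (Int.fract_lt_one _).le⟩, ?_⟩
    rw [← sub_eq_zero]
    simp only [f]
    rw [← map_sub, ← Matrix.mulVec_sub, toTorus_eq_zero]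
    refine mem_imgLattice.2 ⟨fun a => - ⌊x a⌋, ?_⟩
    congr 1
    ext a
    simp [← Int.self_sub_floor]
  exact ⟨hs ▸ isCompact_Icc.image hf⟩

/-- The covering projection `T_{n+1} → T_n`. -/
def proj (n : ℕ) : Torus B (n + 1) →+ Torus B n :=
  QuotientAddGroup.map _ _ (AddMonoidHom.id _) (coverLattice_succ_le B n)

lemma proj_toTorus (n : ℕ) (x : Fin p → ℝ) : proj B n (toTorus B (n + 1) x) = toTorus B n x := rfl

lemma continuous_proj (n : ℕ) : Continuous (proj B n) :=
  Continuous.quotient_lift (continuous_toTorus B n) _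

lemma proj_surjective (n : ℕ) : Function.Surjective (proj B n) := fun y => by
  obtain ⟨x, rfl⟩ := toTorus_surjective B n y
  exact ⟨toTorus B (n + 1) x, rfl⟩

/-- The dual group of `ℤ_B`, that is, `A ℤ^p / ℤ^p`. -/
abbrev ZBdual : Type := dualLattice B 1 ⧸ (intLattice p).addSubgroupOf (dualLattice B 1)

/-- The section `s` of `A ℤ^p → A ℤ^p / ℤ^p` with values in `[0,1)^p`. -/
def sec (k : ZBdual B) : Fin p → ℝ := fun a => Int.fract ((Quotient.out k).1 a)

lemma sec_sub_mem (z : dualLattice B 1) : z.1 - sec B (z : ZBdual B) ∈ intLattice p := by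
  have h := QuotientAddGroup.eq.1 (QuotientAddGroup.out_eq' (z : ZBdual B))
  obtain ⟨w, hw⟩ := mem_intLattice.1 (AddSubgroup.mem_addSubgroupOf.1 h)
  refine mem_intLattice.2 ⟨fun a => w a + ⌊(Quotient.out (z : ZBdual B)).1 a⌋, ?_⟩
  ext a
  have ha := congrFun hw a
  have hf := Int.self_sub_floor ((Quotient.out (z : ZBdual B)).1 a)
  simp only [AddSubgroup.coe_add, NegMemClass.coe_neg, Pi.add_apply, Pi.neg_apply] at ha
  simp only [Pi.sub_apply, sec, Int.cast_add, ← hf]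
  linarith

variable [hB : Fact (1 < |B.det|)]

/-- The normalized measure `r^{-n} dm` on `T_n`, that is, the Haar probability measure. -/
def haar (n : ℕ) : Measure (Torus B n) := Measure.addHaarMeasure ⊤

instance (n : ℕ) : (haar B n).IsAddHaarMeasure :=
  inferInstanceAs (Measure.addHaarMeasure ⊤).IsAddHaarMeasure

instance (n : ℕ) : IsProbabilityMeasure (haar B n) :=
  by
  constructor
  have h := Measure.addHaarMeasure_self (K₀ := (⊤ : TopologicalSpace.PositiveCompacts (Torus B n)))
  simpa [haar] using h

lemma measurePreserving_proj (n : ℕ) : MeasurePreserving (proj B n) (haar B (n + 1)) (haar B n) :=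
  AddMonoidHom.measurePreserving (continuous_proj B n) (proj_surjective B n) (by simp)

/-- The character `t ↦ ⟨z, t⟩ = exp (2 π i z · t)` of `T_n`, for `z ∈ A^n ℤ^p`. -/
def char (n : ℕ) (z : dualLattice B n) : C(Torus B n, ℂ) where
  toFun := Quotient.lift
    (fun t : Fin p → ℝ => Complex.exp (2 * Real.pi * Complex.I * (dotProduct z.1 t : ℝ))) (by
      intro x y hxy
      obtain ⟨w, hw⟩ := mem_imgLattice.1 (QuotientAddGroup.leftRel_apply.1 hxy)
      obtain ⟨u, hu⟩ := mem_imgLattice.1 z.2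
      have h : dotProduct z.1 y = dotProduct z.1 x + ((dotProduct u w : ℤ) : ℝ) := by
        have hy : y = x + (-x + y) := by abel
        rw [hy, dotProduct_add, hw, hu, dual_pow_dotProduct]
        simp [dotProduct]
      rw [h, Complex.exp_eq_exp_iff_exists_int]
      refine ⟨- dotProduct u w, ?_⟩
      push_cast
      ring)
  continuous_toFun := Continuous.quotient_lift (by fun_prop) _

/-- `ℤ_B = ℤ^p / B ℤ^p`. -/
abbrev ZB : Type := (Fin p → ℤ) ⧸ B.mulVecLin.toAddMonoidHom.range

/-- `ℤ_B` as the subgroup `B^n ℤ^p / B^{n+1} ℤ^p` of `T_{n+1}`: the class of `g` is sent to the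
class of `B^n g`. -/
def deck (n : ℕ) : ZB B →+ Torus B (n + 1) :=
  QuotientAddGroup.lift _
    ((toTorus B (n + 1)).comp ((realMat B ^ n).mulVecLin.toAddMonoidHom.comp
      (AddMonoidHom.pi fun a => (Int.castAddHom ℝ).comp (Pi.evalAddMonoidHom (fun _ => ℤ) a))))
    (by
      rintro _ ⟨w, rfl⟩
      refine (toTorus_eq_zero B).2 (mem_imgLattice.2 ⟨w, ?_⟩)
      rw [pow_succ, ← Matrix.mulVec_mulVec, realMat_mulVec]
      rfl)

lemma sec_mem (k : ZBdual B) : sec B k ∈ dualLattice B 1 := by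
  obtain ⟨z, rfl⟩ := QuotientAddGroup.mk_surjective k
  have h := (dualLattice B 1).sub_mem z.2 (intLattice_le_dualLattice_one B (sec_sub_mem B z))
  simpa using h

/-- The sections `s_h = A^{h-1} s`, numbered from `0`: `secLevel B n` is `s_{n+1}`, with values in
`A^{n+1} ℤ^p ∩ A^n [0,1)^p`. -/
def secLevel (n : ℕ) (k : ZBdual B) : Fin p → ℝ := (dualMat B ^ n).mulVec (sec B k)

lemma secLevel_mem (n : ℕ) (k : ZBdual B) : secLevel B n k ∈ dualLattice B (n + 1) := by
  obtain ⟨w, hw⟩ := mem_imgLattice.1 (sec_mem B k)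
  refine mem_imgLattice.2 ⟨w, ?_⟩
  rw [secLevel, hw, pow_one, pow_succ, Matrix.mulVec_mulVec]

/-- The duality `⟨k, g⟩` between `ℤ_B`, seen in `T_1`, and its dual group. -/
def pairing (k : ZBdual B) (g : ZB B) : ℂ := char B 1 ⟨sec B k, sec_mem B k⟩ (deck B 0 g)

/-- The unitaries `σ(k)(t) = conj ⟨s_{n+1}(k), t⟩` in `C(T_{n+1})`. -/
def sigma (n : ℕ) (k : ZBdual B) : C(Torus B (n + 1), ℂ) :=
  star (char B (n + 1) ⟨secLevel B n k, secLevel_mem B n k⟩)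

lemma det_pos_natAbs : 0 < B.det.natAbs := by
  rw [Int.natAbs_pos]
  intro h0
  have := hB.out
  simp [h0] at this

instance : Finite (ZB B) := by
  refine AddCommGroup.finite_of_fg_isAddTorsion _ fun g => ?_
  obtain ⟨g, rfl⟩ := QuotientAddGroup.mk_surjective g
  rw [isOfFinAddOrder_iff_zsmul_eq_zero]
  refine ⟨B.det, Int.natAbs_pos.1 (det_pos_natAbs B), ?_⟩
  rw [← QuotientAddGroup.mk_zsmul, QuotientAddGroup.eq_zero_iff]
  refine ⟨B.adjugate.mulVec g, ?_⟩
  change B.mulVec (B.adjugate.mulVec g) = B.det • g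
  rw [Matrix.mulVec_mulVec, Matrix.mul_adjugate, Matrix.smul_mulVec, Matrix.one_mulVec]

instance : Finite (ZBdual B) := by
  let f : (Fin p → ℤ) →+ ZBdual B := (QuotientAddGroup.mk' _).comp
    { toFun := fun w => ⟨(dualMat B ^ 1).mulVec (fun a => (w a : ℝ)), mem_imgLattice.2 ⟨w, rfl⟩⟩
      map_zero' := Subtype.ext (by ext a; simp [Matrix.mulVec, dotProduct])
      map_add' := fun x y => Subtype.ext (by
        ext a; simp [Matrix.mulVec, dotProduct, mul_add, Finset.sum_add_distrib]) }
  have hf : Function.Surjective f := by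
    intro k
    obtain ⟨z, rfl⟩ := QuotientAddGroup.mk_surjective k
    obtain ⟨w, hw⟩ := mem_imgLattice.1 z.2
    exact ⟨w, congrArg _ (Subtype.ext hw.symm)⟩
  have hfg : AddGroup.FG (ZBdual B) := AddGroup.fg_of_surjective hf
  refine AddCommGroup.finite_of_fg_isAddTorsion _ fun k => ?_
  obtain ⟨w, rfl⟩ := hf k
  rw [isOfFinAddOrder_iff_zsmul_eq_zero]
  refine ⟨B.det, Int.natAbs_pos.1 (det_pos_natAbs B), ?_⟩
  rw [← map_zsmul]
  refine (QuotientAddGroup.eq_zero_iff _).2 (AddSubgroup.mem_addSubgroupOf.2 ?_)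
  refine mem_intLattice.2 ⟨B.transpose.adjugate.mulVec w, ?_⟩
  have h1 : (dualMat B).mulVec ((realMat B).transpose.mulVec
      ((realMat B.transpose.adjugate).mulVec (fun a => (w a : ℝ))))
      = (realMat B.transpose.adjugate).mulVec (fun a => (w a : ℝ)) := by
    rw [Matrix.mulVec_mulVec, dualMat, Matrix.nonsing_inv_mul, Matrix.one_mulVec]
    rw [Matrix.det_transpose]
    exact isUnit_det_realMat B
  have h2 : (realMat B).transpose = realMat B.transpose := rfl
  rw [realMat_mulVec, h2, realMat_mulVec, Matrix.mulVec_mulVec, Matrix.mul_adjugate,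
    Matrix.det_transpose, Matrix.smul_mulVec, Matrix.one_mulVec] at h1
  change (dualMat B ^ 1).mulVec (fun a => (((B.det • w) a : ℤ) : ℝ)) = _
  rw [pow_one]
  exact h1

instance : Fintype (ZB B) := Fintype.ofFinite _

instance : Fintype (ZBdual B) := Fintype.ofFinite _

instance : DecidableEq (ZBdual B) := Classical.decEq _

end Torus

/-! ### The covering unitaries -/

section Unitaries

variable {p : ℕ} (B : Matrix (Fin p) (Fin p) ℤ) [hB : Fact (1 < |B.det|)]

/-- `L²(T_n, r^{-n} dm)`. -/
abbrev L2 (n : ℕ) : Type := Lp ℂ 2 (haar B n)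

/-- Multiplication by a continuous function on `L²(T_n)`. -/
def mulOp (n : ℕ) (f : C(Torus B n, ℂ)) : L2 B n →L[ℂ] L2 B n :=
  (ContinuousLinearMap.mul ℂ ℂ).holderL (haar B n) ∞ 2 2 (ContinuousMap.toLp ∞ (haar B n) ℂ f)

/-- The translation `ξ ↦ ξ(· - g)` on `L²(T_n)`. -/
def translate (n : ℕ) (g : Torus B n) : L2 B n →L[ℂ] L2 B n :=
  (Lp.compMeasurePreservingₗᵢ ℂ (fun t => t - g)
    (measurePreserving_sub_right (haar B n) g)).toContinuousLinearMap

/-- The pull-back `η ↦ η ∘ proj`, which embeds `L²(T_n)` into `L²(T_{n+1})` as the functions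
that are `B^n ℤ^p`-periodic. -/
def pull (n : ℕ) : L2 B n →L[ℂ] L2 B (n + 1) :=
  (Lp.compMeasurePreservingₗᵢ ℂ (proj B n) (measurePreserving_proj B n)).toContinuousLinearMap

/-- The projection `E_k(ξ)(t) = r⁻¹ ∑_{g ∈ ℤ_B} ⟨-k, g⟩ ξ(t - g)` of `L²(T_{n+1})` onto the
`k`-th eigenspace of `ℤ_B`, with `r = |det B|`. -/
def eigenProj (n : ℕ) (k : ZBdual B) : L2 B (n + 1) →L[ℂ] L2 B (n + 1) :=
  ((|B.det| : ℤ) : ℂ)⁻¹ • ∑ g : ZB B, pairing B (-k) g • translate B (n + 1) (deck B n g)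

/-- The operator `v_{n+1} : L²(T_{n+1}) → L²(T_n) ⊗ ℂ^r`, `ξ ↦ (σ(k)⁻¹ E_k(ξ))_k`.
Here `σ(k)⁻¹ = conj σ(k)`, and the adjoint of the isometry `pull` turns the
`B^n ℤ^p`-periodic function `σ(k)⁻¹ E_k(ξ)` into the corresponding function on `T_n`. -/
def coverStep (n : ℕ) : L2 B (n + 1) →L[ℂ] Amp (ZBdual B) (L2 B n) :=
  tuple fun k => (ContinuousLinearMap.adjoint (pull B n)).comp
    ((mulOp B (n + 1) (star (sigma B n k))).comp (eigenProj B n k))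

/-- The operator `(v_1 ⊗ I) ∘ (v_2 ⊗ I) ∘ ⋯ ∘ v_n : L²(T_n) → L²(T_0) ⊗ (ℂ^r)^{⊗ n}`. -/
def coverMap : (n : ℕ) → L2 B n →L[ℂ] Amp (Fin n → ZBdual B) (L2 B 0)
  | 0 => tuple fun _ => ContinuousLinearMap.id ℂ (L2 B 0)
  | n + 1 => tuple fun j => (component (Fin.init j : Fin n → ZBdual B)).comp
      ((coverMap n).comp ((component (j (Fin.last n))).comp (coverStep B n)))

/-- `ℂ^{2^[p/2]} ⊗ L²(T_n, r^{-n} dm)`. -/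
abbrev Spinors (n : ℕ) : Type := Amp (Fin (2 ^ (p / 2))) (L2 B n)

/-- `ℂ^{2^[p/2]} ⊗ L²(T_0, dm) ⊗ (ℂ^r)^{⊗ n}`. -/
abbrev BaseSpinors (n : ℕ) : Type := Amp (Fin n → ZBdual B) (Spinors B 0)

/-- The operator `V_n = I ⊗ [(v_1 ⊗ I) ∘ (v_2 ⊗ I) ∘ ⋯ ∘ v_n]`. -/
def coverV (n : ℕ) : Spinors B n →L[ℂ] BaseSpinors B n :=
  tuple fun j => tuple fun l => (component j).comp ((coverMap B n).comp (component l))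

end Unitaries

/-! ### The Dirac operators -/

section Dirac

variable {p : ℕ} (B : Matrix (Fin p) (Fin p) ℤ) [hB : Fact (1 < |B.det|)]

/-- The function `f` on `T_n` is of class `C^m`. -/
def IsOfClass (m : WithTop ℕ∞) {n : ℕ} (f : Torus B n → ℂ) : Prop :=
  ContDiff ℝ m (fun t : Fin p → ℝ => f (toTorus B n t))

/-- `f'` is the partial derivative `∂^a f` on `T_n`. -/
def IsPartial {n : ℕ} (a : Fin p) (f f' : Torus B n → ℂ) : Prop :=
  ∀ x, HasDerivAt (fun τ : ℝ => f (x + toTorus B n (τ • Pi.single a 1))) (f' x) 0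

/-- The graph of the weak partial derivative: the pairs `(ξ, η)` in `L²(T_n)` with
`∫ conj (∂^a f) ξ = - ∫ conj f η` for all smooth functions `f` on `T_n`. -/
def weakPartialGraph (n : ℕ) (a : Fin p) : Submodule ℂ (L2 B n × L2 B n) where
  carrier := {q | ∀ f f' : C(Torus B n, ℂ), IsOfClass B ∞ f → IsPartial B a f f' →
    inner ℂ (ContinuousMap.toLp 2 (haar B n) ℂ f') q.1
      = - inner ℂ (ContinuousMap.toLp 2 (haar B n) ℂ f) q.2}
  add_mem' := fun h₁ h₂ f f' hf hf' => by
    rw [Prod.fst_add, Prod.snd_add, inner_add_right, inner_add_right, h₁ f f' hf hf',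
      h₂ f f' hf hf', neg_add]
  zero_mem' := fun f f' _ _ => by simp
  smul_mem' := fun c q h f f' hf hf' => by
    rw [Prod.smul_fst, Prod.smul_snd, inner_smul_right, inner_smul_right, h f f' hf hf', mul_neg]

/-- The weak partial derivative `∂^a` as an unbounded operator on `L²(T_n)`. -/
def weakPartial (n : ℕ) (a : Fin p) : L2 B n →ₗ.[ℂ] L2 B n :=
  (weakPartialGraph B n a).toLinearPMap

/-- The matrices `ε^a` are self-adjoint and represent the Clifford algebra of `ℝ^p`:
`ε^a ε^b + ε^b ε^a = 2 δ_{ab}`. -/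
def IsClifford (ε : Fin p → Matrix (Fin (2 ^ (p / 2))) (Fin (2 ^ (p / 2))) ℂ) : Prop :=
  (∀ a, (ε a).IsHermitian) ∧
    ∀ a b, ε a * ε b + ε b * ε a = if a = b then 2 else 0

/-- The operator `ε ⊗ I` on `ℂ^{2^[p/2]} ⊗ L²(T_n)`. -/
def cliffordMul (n : ℕ) (ε : Matrix (Fin (2 ^ (p / 2))) (Fin (2 ^ (p / 2))) ℂ) :
    Spinors B n →L[ℂ] Spinors B n :=
  opTensor (ContinuousLinearMap.id ℂ (L2 B n)) ε

/-- The Dirac operator `D_n = -i ∑_a ε^a ⊗ ∂^a` on `ℂ^{2^[p/2]} ⊗ L²(T_n)`; its domain is the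
intersection of the domains of the operators `I ⊗ ∂^a`, that is, the Sobolev space `H¹`. -/
def dirac (ε : Fin p → Matrix (Fin (2 ^ (p / 2))) (Fin (2 ^ (p / 2))) ℂ) (n : ℕ) :
    Spinors B n →ₗ.[ℂ] Spinors B n where
  domain := ⨅ a, (amplify (Fin (2 ^ (p / 2))) (weakPartial B n a)).domain
  toFun := (-Complex.I) • ∑ a, (cliffordMul B n (ε a) : Spinors B n →ₗ[ℂ] Spinors B n) ∘ₗ
    (amplify (Fin (2 ^ (p / 2))) (weakPartial B n a)).toFun ∘ₗ
      Submodule.inclusion (iInf_le _ a)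

/-- The Dirac operator `V_n D_n V_n*`. -/
def diracHat (ε : Fin p → Matrix (Fin (2 ^ (p / 2))) (Fin (2 ^ (p / 2))) ℂ) (n : ℕ) :
    BaseSpinors B n →ₗ.[ℂ] BaseSpinors B n :=
  conjOp (coverV B n) (dirac B ε n)

/-- The operator `∑_a ε^a ⊗ I ⊗ (∑_h I^{⊗ h-1} ⊗ diag(s_h(·)^a) ⊗ I^{⊗ n-h})`. -/
def sectionOp (ε : Fin p → Matrix (Fin (2 ^ (p / 2))) (Fin (2 ^ (p / 2))) ℂ) (n : ℕ) :
    BaseSpinors B n →L[ℂ] BaseSpinors B n :=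
  ∑ a, opTensor (cliffordMul B 0 (ε a))
    (∑ h : Fin n, inSlot h (Matrix.diagonal fun k : ZBdual B => ((secLevel B h k a : ℝ) : ℂ)))

/-- The operator `I ⊗ f` on `ℂ^{2^[p/2]} ⊗ L²(T_n)`, for a continuous function `f` on `T_n`. -/
def spinorMul (n : ℕ) (f : C(Torus B n, ℂ)) : Spinors B n →L[ℂ] Spinors B n :=
  opTensor (mulOp B n f) 1

/-- `C¹(T_n)` as a *-subalgebra of `C(T_n)`. -/
def C1 (n : ℕ) : StarSubalgebra ℂ C(Torus B n, ℂ) where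
  carrier := {f | IsOfClass B 1 f}
  mul_mem' := fun {f g} hf hg => by
    have hf : ContDiff ℝ 1 (fun t : Fin p → ℝ => f (toTorus B n t)) := hf
    have hg : ContDiff ℝ 1 (fun t : Fin p → ℝ => g (toTorus B n t)) := hg
    exact hf.mul hg
  add_mem' := fun {f g} hf hg => by
    have hf : ContDiff ℝ 1 (fun t : Fin p → ℝ => f (toTorus B n t)) := hf
    have hg : ContDiff ℝ 1 (fun t : Fin p → ℝ => g (toTorus B n t)) := hg
    exact hf.add hg
  algebraMap_mem' := fun c => by
    have h : ContDiff ℝ 1 (fun _ : Fin p → ℝ => c) := contDiff_const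
    simpa [IsOfClass] using h
  star_mem' := fun {f} hf => by
    have hf : ContDiff ℝ 1 (fun t : Fin p → ℝ => f (toTorus B n t)) := hf
    exact Complex.conjCLE.contDiff.comp hf

end Dirac

end TorusCover

end

open TorusCover

noncomputable section

namespace TorusCover

/-! ### Characters of the tori and the Fourier basis of `L2 B n`. -/

section Characters

variable {p : ℕ} (B : Matrix (Fin p) (Fin p) ℤ) [hB : Fact (1 < |B.det|)]

/-! Everything is diagonalised by Fourier series. The characters `⟨z, ·⟩` with `z ∈ A^n ℤ^p` form a
Hilbert basis of `L²(T_n)` (`fourierBasis`, by Stone–Weierstrass). Each element of `A^{n+1} ℤ^p` is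
`z - s_{n+1}(k)` for exactly one `z ∈ A^n ℤ^p` and one `k` (`shift`). On the character of that
weight `E_k` is the identity and the other `E_{k'}` vanish, and multiplication by `σ(k)⁻¹` moves the
weight to `z`. So `v_{n+1}` sends this character to `⟨z, ·⟩ ⊗ e_k` (`coverStep_char`).

Iterating, `V_n` sends `e_l ⊗ ⟨z - ∑ h, s_h(j_h), ·⟩` to `e_l ⊗ ⟨z, ·⟩ ⊗ e_j` (`coverV_single`): a
bijection of orthonormal bases, hence unitarity.

A pair lies in the graph of the weak `∂^a` exactly when the Fourier coefficients of its second entry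
are `2πi z_a` times those of its first (`mem_weakPartialGraph_iff`). Replacing the weight `z` by `z
- ∑ h, s_h(j_h)` turns `∂^a` into `∂^a - 2πi ∑ h, s_h(j_h)^a` on the component `j`, domains included
(`weakPartialGraph_coverV`). Multiplying by `-i ε^a` and summing over `a` gives the formula
`diracHat_eq`.

The spectral triple is proved for `D_n` on `T_n` and carried over by `V_n`
(`IsSpectralTriple.conj`). The symbol `2π ∑ a, z_a ε^a` squares to the scalar `4π²|z|²`, so `(D -
w)⁻¹ = (D + w)(D² - w²)⁻¹` is a finite sum of diagonal operators tensored with matrices, with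
eigenvalues tending to `0`. Self-adjointness follows from symmetry and the surjectivity of `D ± i`;
commutators are bounded by the Leibniz rule. -/

lemma char_toTorus (n : ℕ) (z : dualLattice B n) (x : Fin p → ℝ) :
    char B n z (toTorus B n x) =
      Complex.exp (2 * Real.pi * Complex.I * (dotProduct z.1 x : ℝ)) := rfl

lemma char_zero (n : ℕ) : char B n 0 = 1 := by
  ext t
  obtain ⟨x, rfl⟩ := toTorus_surjective B n t
  simp [char_toTorus]

lemma char_add (n : ℕ) (z w : dualLattice B n) : char B n (z + w) = char B n z * char B n w := by
  ext t
  obtain ⟨x, rfl⟩ := toTorus_surjective B n t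
  simp only [ContinuousMap.mul_apply, char_toTorus, ← Complex.exp_add]
  congr 1
  simp [add_dotProduct]
  ring

lemma char_neg (n : ℕ) (z : dualLattice B n) : char B n (-z) = star (char B n z) := by
  ext t
  obtain ⟨x, rfl⟩ := toTorus_surjective B n t
  simp only [ContinuousMap.star_apply, char_toTorus, Complex.star_def, ← Complex.exp_conj]
  congr 1
  simp [neg_dotProduct, Complex.conj_ofNat]

lemma char_apply_add (n : ℕ) (z : dualLattice B n) (t u : Torus B n) :
    char B n z (t + u) = char B n z t * char B n z u := by
  obtain ⟨x, rfl⟩ := toTorus_surjective B n t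
  obtain ⟨y, rfl⟩ := toTorus_surjective B n u
  rw [← map_add]
  simp only [char_toTorus, ← Complex.exp_add]
  congr 1
  simp [dotProduct_add]
  ring

lemma char_apply_zero (n : ℕ) (z : dualLattice B n) : char B n z 0 = 1 := by
  rw [← map_zero (toTorus B n), char_toTorus]
  simp

/-- Write `t` as the class of `B^n u`. By duality the character of weight `A^n e_a` takes the value
`exp(2πi u_a)` at `t`; if all of these are `1`, then `u` is integral. -/
lemma exists_char_ne_one {n : ℕ} {t : Torus B n} (ht : t ≠ 0) : ∃ z, char B n z t ≠ 1 := by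
  by_contra! h
  obtain ⟨x, rfl⟩ := toTorus_surjective B n t
  obtain ⟨u, rfl⟩ : ∃ u, (realMat B ^ n).mulVec u = x :=
    (Matrix.mulVec_surjective_iff_isUnit.2 ((isUnit_realMat B).pow n)) x
  refine ht ((toTorus_eq_zero B).2 (mem_imgLattice.2 ?_))
  have key : ∀ a, ∃ m : ℤ, u a = m := fun a => by
    have h1 := h ⟨_, mem_imgLattice.2 ⟨Pi.single a 1, rfl⟩⟩
    rw [char_toTorus, dual_pow_dotProduct, Complex.exp_eq_one_iff] at h1
    obtain ⟨m, hm⟩ := h1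
    refine ⟨m, ?_⟩
    have h2 : dotProduct (fun b => ((Pi.single a 1 : Fin p → ℤ) b : ℝ)) u = u a := by
      have : (fun b => ((Pi.single a 1 : Fin p → ℤ) b : ℝ)) = Pi.single a 1 := by
        ext b
        by_cases hb : b = a
        · subst hb; simp
        · simp [hb]
      rw [this, single_one_dotProduct]
    rw [h2, mul_comm] at hm
    exact_mod_cast mul_right_cancel₀ Complex.two_pi_I_ne_zero hm
  choose m hm using key
  exact ⟨m, by congr 1; exact funext hm⟩

lemma exists_char_apply_ne_one {n : ℕ} {z : dualLattice B n} (hz : z ≠ 0) :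
    ∃ t, char B n z t ≠ 1 := by
  obtain ⟨a, ha⟩ := Function.ne_iff.1 (fun h => hz (Subtype.ext h) : z.1 ≠ 0)
  -- At this point `z · x = 1/2`, so the character takes the value `-1`.
  refine ⟨toTorus B n (Pi.single a (1 / (2 * z.1 a))), ?_⟩
  rw [char_toTorus, dotProduct_single]
  have h0 : z.1 a ≠ 0 := ha
  have : (2 * Real.pi * Complex.I * ((z.1 a * (1 / (2 * z.1 a)) : ℝ) : ℂ)) = Real.pi * Complex.I := by
    rw [show z.1 a * (1 / (2 * z.1 a)) = 1 / 2 by field_simp]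
    push_cast
    ring
  rw [this, Complex.exp_pi_mul_I]
  norm_num

/-- Translation by `u` multiplies the integral by the value of the character at `u`, so the integral
of a nontrivial character vanishes. -/
lemma integral_char (n : ℕ) (z : dualLattice B n) :
    ∫ t, char B n z t ∂haar B n = if z = 0 then 1 else 0 := by
  split_ifs with h
  · simp [h, char_zero]
  · obtain ⟨u, hu⟩ := exists_char_apply_ne_one B h
    have h1 := integral_add_right_eq_self (μ := haar B n) (fun t => char B n z t) u
    simp only [char_apply_add, integral_mul_const] at h1
    have h2 : (∫ t, char B n z t ∂haar B n) * (char B n z u - 1) = 0 := by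
      rw [mul_sub, h1]; ring
    exact (mul_eq_zero.1 h2).resolve_right (sub_ne_zero.2 hu)

instance (n : ℕ) : T2Space (Torus B n) := by
  refine ⟨fun x y hxy => ?_⟩
  obtain ⟨z, hz⟩ := exists_char_ne_one B (sub_ne_zero.2 hxy)
  refine separated_by_continuous (char B n z).continuous fun h => hz ?_
  rw [sub_eq_add_neg, char_apply_add, h, ← char_apply_add, add_neg_cancel, char_apply_zero]

/-- The *-subalgebra of `C(T_n)` generated by the characters. -/
def charSubalgebra (n : ℕ) : StarSubalgebra ℂ C(Torus B n, ℂ) where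
  toSubalgebra := Algebra.adjoin ℂ (Set.range (char B n))
  star_mem' := by
    change Algebra.adjoin ℂ (Set.range (char B n)) ≤ star (Algebra.adjoin ℂ (Set.range (char B n)))
    refine Algebra.adjoin_le ?_
    rintro _ ⟨z, rfl⟩
    exact Algebra.subset_adjoin ⟨-z, char_neg B n z⟩

/-- Products of characters are characters, so the algebra they generate is already their linear
span. Density of the algebra thus becomes density of the span. -/
lemma charSubalgebra_coe (n : ℕ) :
    (charSubalgebra B n).toSubalgebra.toSubmodule = Submodule.span ℂ (Set.range (char B n)) := by
  apply Algebra.adjoin_eq_span_of_subset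
  refine .trans (fun x => Submonoid.closure_induction (fun _ => id) ⟨0, char_zero B n⟩ ?_)
    Submodule.subset_span
  rintro _ _ _ _ ⟨m, rfl⟩ ⟨k, rfl⟩
  exact ⟨m + k, char_add B n m k⟩

lemma charSubalgebra_separatesPoints (n : ℕ) : (charSubalgebra B n).SeparatesPoints := by
  intro x y hxy
  obtain ⟨z, hz⟩ := exists_char_ne_one B (sub_ne_zero.2 hxy)
  refine ⟨_, ⟨char B n z, Algebra.subset_adjoin ⟨z, rfl⟩, rfl⟩, fun h => hz ?_⟩
  change char B n z x = char B n z y at h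
  rw [sub_eq_add_neg, char_apply_add, h, ← char_apply_add, add_neg_cancel, char_apply_zero]

lemma charSubalgebra_closure (n : ℕ) : (charSubalgebra B n).topologicalClosure = ⊤ :=
  ContinuousMap.starSubalgebra_topologicalClosure_eq_top_of_separatesPoints _
    (charSubalgebra_separatesPoints B n)

lemma span_char_closure (n : ℕ) :
    (Submodule.span ℂ (Set.range (char B n))).topologicalClosure = ⊤ := by
  rw [← charSubalgebra_coe]
  exact congr_arg (Subalgebra.toSubmodule <| StarSubalgebra.toSubalgebra ·)
    (charSubalgebra_closure B n)

instance (n : ℕ) : (haar B n).Regular :=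
  inferInstanceAs (Measure.addHaarMeasure ⊤).Regular

/-- A continuous function as an element of `L²(T_n)`. -/
abbrev toL2 (n : ℕ) (f : C(Torus B n, ℂ)) : L2 B n := ContinuousMap.toLp 2 (haar B n) ℂ f

lemma orthonormal_char (n : ℕ) : Orthonormal ℂ (fun z => toL2 B n (char B n z)) := by
  classical
  rw [orthonormal_iff_ite]
  intro z w
  have h : ∀ t, char B n w t * (starRingEnd ℂ) (char B n z t) = char B n (w - z) t := fun t => by
    rw [sub_eq_add_neg, char_add, char_neg]; rfl
  simp only [toL2, ContinuousMap.inner_toLp, h, integral_char, sub_eq_zero, eq_comm (a := z)]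

lemma span_toL2_char_closure (n : ℕ) :
    (Submodule.span ℂ (Set.range fun z => toL2 B n (char B n z))).topologicalClosure = ⊤ := by
  simpa only [Submodule.map_span, ContinuousLinearMap.coe_coe, ← Set.range_comp,
    Function.comp_def] using
    (ContinuousMap.toLp_denseRange ℂ (haar B n) ℂ (by norm_num)).topologicalClosure_map_submodule
      (span_char_closure B n)

/-- The characters as a Hilbert basis of `L²(T_n)`. -/
def fourierBasis (n : ℕ) : HilbertBasis (dualLattice B n) ℂ (L2 B n) :=
  HilbertBasis.mk (orthonormal_char B n) (span_toL2_char_closure B n).ge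

lemma fourierBasis_apply (n : ℕ) (z : dualLattice B n) :
    fourierBasis B n z = toL2 B n (char B n z) := by
  simp [fourierBasis]

end Characters

/-! ### The orders of `ZB B` and of its dual. -/

section Cardinality

lemma card_quotient_range_mulVecLin {p : ℕ} (M : Matrix (Fin p) (Fin p) ℤ) (hM : M.det ≠ 0) :
    Nat.card ((Fin p → ℤ) ⧸ M.mulVecLin.toAddMonoidHom.range) = M.det.natAbs := by
  have hinj : Function.Injective M.mulVecLin := Matrix.mulVec_injective_of_det_ne_zero hM
  let e := LinearEquiv.ofInjective M.mulVecLin hinj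
  have h := Submodule.natAbs_det_equiv (LinearMap.range M.mulVecLin) e
  have h2 : ((LinearMap.range M.mulVecLin).subtype ∘ₗ
      AddMonoidHom.toIntLinearMap (e : (Fin p → ℤ) →+ LinearMap.range M.mulVecLin))
      = Matrix.toLin' M := by
    ext; rfl
  rw [h2, LinearMap.det_toLin'] at h
  exact h.symm

variable {p : ℕ} (B : Matrix (Fin p) (Fin p) ℤ)

/-- The surjection `ℤ^p → A ℤ^p / ℤ^p`, `w ↦ A w`. -/
def intToZBdual : (Fin p → ℤ) →+ ZBdual B := (QuotientAddGroup.mk' _).comp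
  { toFun := fun w => ⟨(dualMat B ^ 1).mulVec (fun a => (w a : ℝ)), mem_imgLattice.2 ⟨w, rfl⟩⟩
    map_zero' := Subtype.ext (by ext a; simp [Matrix.mulVec, dotProduct])
    map_add' := fun x y => Subtype.ext (by
      ext a; simp [Matrix.mulVec, dotProduct, mul_add, Finset.sum_add_distrib]) }

lemma intToZBdual_surjective : Function.Surjective (intToZBdual B) := by
  intro k
  obtain ⟨z, rfl⟩ := QuotientAddGroup.mk_surjective k
  obtain ⟨w, hw⟩ := mem_imgLattice.1 z.2
  exact ⟨w, congrArg _ (Subtype.ext hw.symm)⟩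

variable [hB : Fact (1 < |B.det|)]

lemma card_ZB : (Fintype.card (ZB B) : ℤ) = |B.det| := by
  rw [← Nat.card_eq_fintype_card, card_quotient_range_mulVecLin _
    (Int.natAbs_pos.1 (det_pos_natAbs B)), Int.natCast_natAbs]

lemma dualMat_pow_mulVec_injective (n : ℕ) : Function.Injective (dualMat B ^ n).mulVec := by
  refine Matrix.mulVec_injective_iff_isUnit.2 (IsUnit.pow n ?_)
  rw [Matrix.isUnit_iff_isUnit_det, dualMat, Matrix.isUnit_nonsing_inv_det_iff,
    Matrix.det_transpose]
  exact isUnit_det_realMat B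

lemma dualMat_mulVec_transpose (u : Fin p → ℤ) :
    (dualMat B ^ 1).mulVec (fun a => ((B.transpose.mulVec u a : ℤ) : ℝ)) = fun a => (u a : ℝ) := by
  have h : (fun a => ((B.transpose.mulVec u a : ℤ) : ℝ))
      = (realMat B).transpose.mulVec (fun a => (u a : ℝ)) := by
    rw [← realMat_mulVec]
    rfl
  have hu : IsUnit (realMat B).transpose.det := by
    rw [Matrix.det_transpose]
    exact isUnit_det_realMat B
  rw [h, pow_one, Matrix.mulVec_mulVec, dualMat, Matrix.nonsing_inv_mul _ hu, Matrix.one_mulVec]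

/-- `A w` is integral iff `w ∈ Bᵀ ℤ^p`. Hence the dual group is `ℤ^p / Bᵀ ℤ^p`, and its order is the
absolute value of the determinant. -/
lemma ker_intToZBdual :
    (intToZBdual B).ker = B.transpose.mulVecLin.toAddMonoidHom.range := by
  ext w
  rw [AddMonoidHom.mem_ker]
  refine (QuotientAddGroup.eq_zero_iff _).trans (AddSubgroup.mem_addSubgroupOf.trans ?_)
  rw [mem_intLattice]
  constructor
  · rintro ⟨u, hu⟩
    refine ⟨u, ?_⟩
    have := dualMat_pow_mulVec_injective B 1 ((dualMat_mulVec_transpose B u).trans hu.symm)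
    ext a
    exact_mod_cast congrFun this a
  · rintro ⟨u, rfl⟩
    exact ⟨u, dualMat_mulVec_transpose B u⟩

lemma card_ZBdual : (Fintype.card (ZBdual B) : ℤ) = |B.det| := by
  have h0 : B.transpose.det ≠ 0 := by
    rw [Matrix.det_transpose]; exact Int.natAbs_pos.1 (det_pos_natAbs B)
  have h1 := card_quotient_range_mulVecLin B.transpose h0
  rw [← ker_intToZBdual, Nat.card_congr (QuotientAddGroup.quotientKerEquivOfSurjective _
    (intToZBdual_surjective B)).toEquiv, Nat.card_eq_fintype_card, Matrix.det_transpose] at h1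
  rw [h1, Int.natCast_natAbs]

end Cardinality

/-! ### Coordinates in Hilbert bases and in amplifications. -/

section HilbertBasis

variable {ι K K' : Type*} [NormedAddCommGroup K] [InnerProductSpace ℂ K]
  [NormedAddCommGroup K'] [InnerProductSpace ℂ K']

lemma HilbertBasis.ext_inner (b : HilbertBasis ι ℂ K) {x y : K}
    (h : ∀ i, inner ℂ (b i) x = inner ℂ (b i) y) : x = y := by
  apply b.repr.injective
  ext i
  simpa [b.repr_apply_apply] using h i

lemma HilbertBasis.clm_ext (b : HilbertBasis ι ℂ K) {S T : K →L[ℂ] K'}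
    (h : ∀ i, S (b i) = T (b i)) : S = T :=
  ContinuousLinearMap.ext_on (dense_iff_closure_eq.2 (by
    rw [← Submodule.topologicalClosure_coe, b.dense_span]; rfl)) (by rintro _ ⟨i, rfl⟩; exact h i)

variable {J : Type*} [Fintype J]

lemma tuple_apply (T : J → (K →L[ℂ] K')) (x : K) (j : J) : tuple T x j = T j x := rfl

lemma component_apply (j : J) (x : Amp J K) : component j x = x j := rfl

lemma opTensor_apply (S : K →L[ℂ] K') (M : Matrix J J ℂ) (x : Amp J K) (j : J) :
    opTensor S M x j = ∑ k, M j k • S (x k) := by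
  simp [opTensor, tuple_apply, component_apply]

/-- Turns a coefficient of a component into an inner product on the whole space, where an adjoint
can be moved to the other side. -/
lemma inner_toLp_single [DecidableEq J] (j : J) (x : K) (y : Amp J K) :
    inner ℂ (WithLp.toLp 2 (Pi.single j x) : Amp J K) y = inner ℂ x (y j) := by
  rw [PiLp.inner_apply, Finset.sum_eq_single j]
  · simp
  · intro i _ hi
    simp [hi]
  · simp

lemma amp_ext_inner (b : HilbertBasis ι ℂ K) {x y : Amp J K}
    (h : ∀ i j, inner ℂ (b i) (x j) = inner ℂ (b i) (y j)) : x = y := by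
  ext j
  exact HilbertBasis.ext_inner b fun i => h i j

end HilbertBasis

/-! ### The pairing of `ZB B` with its dual and the coset decomposition of the dual lattices. -/

section Lattice

variable {p : ℕ} (B : Matrix (Fin p) (Fin p) ℤ)

lemma mk_eq_zero_iff (z : dualLattice B 1) : (z : ZBdual B) = 0 ↔ z.1 ∈ intLattice p :=
  (QuotientAddGroup.eq_zero_iff z).trans AddSubgroup.mem_addSubgroupOf

lemma deck_mk (n : ℕ) (u : Fin p → ℤ) : deck B n (QuotientAddGroup.mk u) =
    toTorus B (n + 1) ((realMat B ^ n).mulVec fun a => (u a : ℝ)) := rfl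

variable [hB : Fact (1 < |B.det|)]

lemma dualLattice_le_succ (n : ℕ) : dualLattice B n ≤ dualLattice B (n + 1) := by
  intro x hx
  obtain ⟨w, rfl⟩ := mem_imgLattice.1 hx
  refine mem_imgLattice.2 ⟨B.transpose.mulVec w, ?_⟩
  rw [pow_succ, ← Matrix.mulVec_mulVec]
  congr 1
  rw [← dualMat_mulVec_transpose B, pow_one]

lemma mk_sec (k : ZBdual B) : ((⟨sec B k, sec_mem B k⟩ : dualLattice B 1) : ZBdual B) = k := by
  obtain ⟨z, rfl⟩ := QuotientAddGroup.mk_surjective k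
  refine QuotientAddGroup.eq.2 (AddSubgroup.mem_addSubgroupOf.2 ?_)
  simpa [sub_eq_add_neg, add_comm] using! sec_sub_mem B z

lemma sec_add_sub_mem (k k' : ZBdual B) :
    sec B k + sec B k' - sec B (k + k') ∈ intLattice p := by
  have h := sec_sub_mem B (⟨sec B k, sec_mem B k⟩ + ⟨sec B k', sec_mem B k'⟩)
  rwa [QuotientAddGroup.mk_add, mk_sec, mk_sec] at h

lemma exp_two_pi_dotProduct_int {x : Fin p → ℝ} (hx : x ∈ intLattice p) (u : Fin p → ℤ) :
    Complex.exp (2 * Real.pi * Complex.I * (dotProduct x (fun a => (u a : ℝ)) : ℝ)) = 1 := by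
  obtain ⟨w, rfl⟩ := mem_intLattice.1 hx
  rw [Complex.exp_eq_one_iff]
  exact ⟨dotProduct w u, by simp [dotProduct]; ring⟩

lemma pairing_mk (k : ZBdual B) (u : Fin p → ℤ) : pairing B k (QuotientAddGroup.mk u) =
    Complex.exp (2 * Real.pi * Complex.I * (dotProduct (sec B k) (fun a => (u a : ℝ)) : ℝ)) := by
  rw [pairing, deck_mk, char_toTorus, pow_zero, Matrix.one_mulVec]

/-- The section `s` is not additive, but its defect `s(k) + s(k') - s(k + k')` is integral and pairs
trivially with `ℤ^p`. -/
lemma pairing_add_left (k k' : ZBdual B) (g : ZB B) :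
    pairing B (k + k') g = pairing B k g * pairing B k' g := by
  obtain ⟨u, rfl⟩ := QuotientAddGroup.mk_surjective g
  have h := exp_two_pi_dotProduct_int (sec_add_sub_mem B k k') u
  rw [pairing_mk, pairing_mk, pairing_mk, ← Complex.exp_add, ← mul_one (Complex.exp _), ← h,
    ← Complex.exp_add]
  congr 1
  simp only [sub_dotProduct, add_dotProduct]
  push_cast
  ring

lemma pairing_zero_left (g : ZB B) : pairing B 0 g = 1 := by
  have h := pairing_add_left B 0 0 g
  rw [add_zero] at h
  have h0 : pairing B 0 g ≠ 0 := by
    obtain ⟨u, rfl⟩ := QuotientAddGroup.mk_surjective g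
    rw [pairing_mk]
    exact Complex.exp_ne_zero _
  exact (mul_eq_left₀ h0).1 h.symm

lemma pairing_add_right (k : ZBdual B) (g g' : ZB B) :
    pairing B k (g + g') = pairing B k g * pairing B k g' := by
  rw [pairing, map_add, char_apply_add]; rfl

lemma eq_zero_of_pairing_eq_one {k : ZBdual B} (h : ∀ g, pairing B k g = 1) : k = 0 := by
  rw [← mk_sec B k, mk_eq_zero_iff, mem_intLattice]
  have key : ∀ a, ∃ m : ℤ, sec B k a = m := fun a => by
    have h1 := h (QuotientAddGroup.mk (Pi.single a 1))
    have h2 : (fun b => ((Pi.single a 1 : Fin p → ℤ) b : ℝ)) = Pi.single a 1 := by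
      ext b
      by_cases hb : b = a
      · subst hb; simp
      · simp [hb]
    rw [pairing_mk, h2, dotProduct_single_one, Complex.exp_eq_one_iff] at h1
    obtain ⟨m, hm⟩ := h1
    rw [mul_comm] at hm
    exact ⟨m, by exact_mod_cast mul_right_cancel₀ Complex.two_pi_I_ne_zero hm⟩
  choose m hm using key
  exact ⟨m, funext hm⟩

/-- Orthogonality of characters of a finite group: for `k ≠ 0`, translating the sum by `g₀`
multiplies it by a factor different from `1`. -/
lemma sum_pairing (k : ZBdual B) :
    ∑ g : ZB B, pairing B k g = if k = 0 then ((|B.det| : ℤ) : ℂ) else 0 := by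
  split_ifs with h
  · rw [← card_ZB B]
    simp [h, pairing_zero_left]
  · obtain ⟨g₀, hg⟩ : ∃ g, pairing B k g ≠ 1 := by
      by_contra! h'
      exact h (eq_zero_of_pairing_eq_one B h')
    have h1 := Equiv.sum_comp (Equiv.addRight g₀) (pairing B k)
    simp only [Equiv.coe_addRight, pairing_add_right, ← Finset.sum_mul] at h1
    have h2 : (∑ g, pairing B k g) * (pairing B k g₀ - 1) = 0 := by
      rw [mul_sub, h1]; ring
    exact (mul_eq_zero.1 h2).resolve_right (sub_ne_zero.2 hg)

/-- The bijection `(z, k) ↦ z - s_{n+1}(k)` from `A^n ℤ^p × (A ℤ^p / ℤ^p)` onto `A^{n+1} ℤ^p`. -/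
def shift (n : ℕ) (q : dualLattice B n × ZBdual B) : dualLattice B (n + 1) :=
  ⟨q.1.1, dualLattice_le_succ B n q.1.2⟩ - ⟨secLevel B n q.2, secLevel_mem B n q.2⟩

lemma shift_coe (n : ℕ) (q : dualLattice B n × ZBdual B) :
    (shift B n q : Fin p → ℝ) = q.1.1 - secLevel B n q.2 := rfl

/-- Equal values force `A^n (s(k) - s(k'))` into `A^n ℤ^p`. Cancelling `A^n` makes `s(k) - s(k')`
integral, so `k = k'`. -/
lemma shift_injective (n : ℕ) : Function.Injective (shift B n) := by
  rintro ⟨z, k⟩ ⟨z', k'⟩ h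
  have h1 : z.1 - secLevel B n k = z'.1 - secLevel B n k' := congrArg Subtype.val h
  have h2 : secLevel B n k - secLevel B n k' ∈ dualLattice B n := by
    rw [show secLevel B n k - secLevel B n k' = z.1 - z'.1 by
      linear_combination (exp := 1) -h1]
    exact sub_mem z.2 z'.2
  obtain ⟨w, hw⟩ := mem_imgLattice.1 h2
  rw [secLevel, secLevel, ← Matrix.mulVec_sub] at hw
  have h3 := dualMat_pow_mulVec_injective B n hw
  have hk : k = k' := by
    rw [← sub_eq_zero, ← mk_sec B k, ← mk_sec B k', ← QuotientAddGroup.mk_sub, mk_eq_zero_iff]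
    exact mem_intLattice.2 ⟨w, h3⟩
  subst hk
  exact Prod.ext (Subtype.ext (sub_left_injective h1)) rfl

lemma shift_surjective (n : ℕ) : Function.Surjective (shift B n) := by
  intro z
  obtain ⟨w, hw⟩ := mem_imgLattice.1 z.2
  let y : dualLattice B 1 := ⟨(dualMat B ^ 1).mulVec (fun a => (w a : ℝ)), mem_imgLattice.2 ⟨w, rfl⟩⟩
  have hy : z.1 = (dualMat B ^ n).mulVec y.1 := by
    rw [hw, pow_succ, ← Matrix.mulVec_mulVec, ← pow_one (dualMat B)]
  have h : y.1 + sec B (-(y : ZBdual B)) ∈ intLattice p := by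
    refine (mk_eq_zero_iff B (y + ⟨_, sec_mem B (-(y : ZBdual B))⟩)).1 ?_
    rw [QuotientAddGroup.mk_add, mk_sec, add_neg_cancel]
  obtain ⟨v, hv⟩ := mem_intLattice.1 h
  -- With `z = A^n y`, `y ∈ A ℤ^p`, the index must be the class of `-y`: then `y + s(k)` is integral
  -- and `z + s_{n+1}(k)` lies in `A^n ℤ^p`.
  refine ⟨(⟨z.1 + secLevel B n (-(y : ZBdual B)), mem_imgLattice.2 ⟨v, ?_⟩⟩, -(y : ZBdual B)),
    Subtype.ext ?_⟩
  · rw [hy, secLevel, ← Matrix.mulVec_add, hv]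
  · rw [shift_coe, add_sub_cancel_right]

end Lattice

/-! ### The covering unitaries on characters. -/

section Operators

variable {p : ℕ} (B : Matrix (Fin p) (Fin p) ℤ) [hB : Fact (1 < |B.det|)]

lemma coeFn_toL2 (n : ℕ) (f : C(Torus B n, ℂ)) : toL2 B n f =ᵐ[haar B n] f :=
  ContinuousMap.coeFn_toLp (haar B n) f

lemma coeFn_mulOp (n : ℕ) (f : C(Torus B n, ℂ)) (ξ : L2 B n) :
    mulOp B n f ξ =ᵐ[haar B n] fun t => f t * ξ t := by
  have h := (ContinuousLinearMap.mul ℂ ℂ).coeFn_holder (r := 2)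
    (ContinuousMap.toLp ∞ (haar B n) ℂ f) ξ
  have h2 := ContinuousMap.coeFn_toLp (p := ∞) (𝕜 := ℂ) (haar B n) f
  filter_upwards [h, h2] with t ht ht2
  rw [← ht2]
  exact ht

lemma mulOp_toL2 (n : ℕ) (f g : C(Torus B n, ℂ)) :
    mulOp B n f (toL2 B n g) = toL2 B n (f * g) := by
  apply Lp.ext
  filter_upwards [coeFn_mulOp B n f (toL2 B n g), coeFn_toL2 B n g, coeFn_toL2 B n (f * g)]
    with t h1 h2 h3
  rw [h1, h2, h3, ContinuousMap.mul_apply]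

lemma translate_toL2 (n : ℕ) (g : Torus B n) (f f' : C(Torus B n, ℂ))
    (hf : ∀ t, f (t - g) = f' t) : translate B n g (toL2 B n f) = toL2 B n f' := by
  apply Lp.ext
  have h := Lp.coeFn_compMeasurePreserving (toL2 B n f) (measurePreserving_sub_right (haar B n) g)
  have h2 := (measurePreserving_sub_right (haar B n) g).quasiMeasurePreserving.ae
    (coeFn_toL2 B n f)
  filter_upwards [h, h2, coeFn_toL2 B n f'] with t h1 h2 h3
  rw [h3, ← hf, ← h2]
  exact h1

lemma pull_toL2 (n : ℕ) (f : C(Torus B n, ℂ)) (f' : C(Torus B (n + 1), ℂ))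
    (hf : ∀ t, f (proj B n t) = f' t) : pull B n (toL2 B n f) = toL2 B (n + 1) f' := by
  apply Lp.ext
  have h := Lp.coeFn_compMeasurePreserving (toL2 B n f) (measurePreserving_proj B n)
  have h2 := (measurePreserving_proj B n).quasiMeasurePreserving.ae (coeFn_toL2 B n f)
  filter_upwards [h, h2, coeFn_toL2 B (n + 1) f'] with t h1 h2 h3
  rw [h3, ← hf, ← h2]
  exact h1

lemma adjoint_pull_pull (n : ℕ) (ξ : L2 B n) :
    ContinuousLinearMap.adjoint (pull B n) (pull B n ξ) = ξ := by
  refine ext_inner_left ℂ fun η => ?_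
  rw [ContinuousLinearMap.adjoint_inner_right]
  exact (Lp.compMeasurePreservingₗᵢ ℂ (proj B n) (measurePreserving_proj B n)).inner_map_map η ξ

lemma pull_char (n : ℕ) (z : dualLattice B n) : pull B n (toL2 B n (char B n z)) =
    toL2 B (n + 1) (char B (n + 1) ⟨z.1, dualLattice_le_succ B n z.2⟩) := by
  refine pull_toL2 B n _ _ fun t => ?_
  obtain ⟨x, rfl⟩ := toTorus_surjective B _ t
  rfl

/-- The part of the weight in `A^n ℤ^p` pairs integrally with `B^n g` and drops out. The minus sign
before `s_{n+1}(k)` in `shift` cancels the one from `t - g`, so the character of weight `z -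
s_{n+1}(k)` is in the eigenspace of `k` itself. -/
lemma char_shift_deck (n : ℕ) (q : dualLattice B n × ZBdual B) (g : ZB B) :
    char B (n + 1) (shift B n q) (-deck B n g) = pairing B q.2 g := by
  obtain ⟨u, rfl⟩ := QuotientAddGroup.mk_surjective g
  obtain ⟨w, hw⟩ := mem_imgLattice.1 q.1.2
  have h := exp_two_pi_dotProduct_int (mem_intLattice.2 ⟨w, rfl⟩) u
  rw [deck_mk, ← map_neg, char_toTorus, pairing_mk, shift_coe, hw, secLevel, ← Matrix.mulVec_sub,
    ← Matrix.mulVec_neg, dual_pow_dotProduct, ← mul_one (Complex.exp _), ← h, ← Complex.exp_add]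
  congr 1
  simp only [sub_dotProduct, dotProduct_neg]
  push_cast
  ring

lemma eigenProj_char (n : ℕ) (q : dualLattice B n × ZBdual B) (k : ZBdual B) :
    eigenProj B n k (toL2 B (n + 1) (char B (n + 1) (shift B n q))) =
      if k = q.2 then toL2 B (n + 1) (char B (n + 1) (shift B n q)) else 0 := by
  have ht : ∀ g, translate B (n + 1) (deck B n g) (toL2 B (n + 1) (char B (n + 1) (shift B n q)))
      = pairing B q.2 g • toL2 B (n + 1) (char B (n + 1) (shift B n q)) := fun g => by
    rw [← map_smul]
    refine translate_toL2 B _ _ _ _ fun t => ?_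
    rw [sub_eq_add_neg, char_apply_add, char_shift_deck, ContinuousMap.smul_apply, smul_eq_mul,
      mul_comm]
  simp only [eigenProj, _root_.smul_apply, _root_.sum_apply, ht,
    smul_smul, ← pairing_add_left, ← Finset.sum_smul, sum_pairing, neg_add_eq_zero]
  split_ifs
  · rw [inv_mul_cancel₀, one_smul]
    rw [Int.cast_ne_zero, abs_ne_zero]
    exact Int.natAbs_pos.1 (det_pos_natAbs B)
  · simp

lemma mulOp_star_sigma_char (n : ℕ) (q : dualLattice B n × ZBdual B) :
    mulOp B (n + 1) (star (sigma B n q.2)) (toL2 B (n + 1) (char B (n + 1) (shift B n q))) =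
      pull B n (toL2 B n (char B n q.1)) := by
  rw [mulOp_toL2, sigma, star_star, ← char_add, pull_char, shift, add_sub_cancel]

lemma coverStep_char (n : ℕ) (q : dualLattice B n × ZBdual B) (k : ZBdual B) :
    coverStep B n (toL2 B (n + 1) (char B (n + 1) (shift B n q))) k =
      if k = q.2 then toL2 B n (char B n q.1) else 0 := by
  change ContinuousLinearMap.adjoint (pull B n) (mulOp B (n + 1) (star (sigma B n k))
    (eigenProj B n k _)) = _
  rw [eigenProj_char]
  split_ifs with h
  · rw [h, mulOp_star_sigma_char, adjoint_pull_pull]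
  · simp

/-- The functions `σ(k)⁻¹ E_k(ξ)` are periodic. -/
lemma pull_coverStep (n : ℕ) (ξ : L2 B (n + 1)) (k : ZBdual B) :
    pull B n (coverStep B n ξ k) = mulOp B (n + 1) (star (sigma B n k)) (eigenProj B n k ξ) := by
  suffices h : (pull B n).comp ((component k).comp (coverStep B n)) =
      (mulOp B (n + 1) (star (sigma B n k))).comp (eigenProj B n k) from
    DFunLike.congr_fun h ξ
  refine HilbertBasis.clm_ext (fourierBasis B (n + 1)) fun z => ?_
  obtain ⟨q, rfl⟩ := shift_surjective B n z
  rw [fourierBasis_apply]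
  simp only [ContinuousLinearMap.comp_apply, component_apply, coverStep_char, eigenProj_char]
  split_ifs with h
  · rw [h, mulOp_star_sigma_char]
  · simp

/-- The dual form of `coverStep_char`: the step only relabels Fourier coefficients. In this form it
applies to arbitrary vectors and iterates up the tower of coverings. -/
lemma inner_char_coverStep (n : ℕ) (q : dualLattice B n × ZBdual B) (ξ : L2 B (n + 1)) :
    inner ℂ (fourierBasis B n q.1) (coverStep B n ξ q.2) =
      inner ℂ (fourierBasis B (n + 1) (shift B n q)) ξ := by
  classical
  suffices h : (innerSL ℂ (fourierBasis B n q.1)).comp ((component q.2).comp (coverStep B n)) =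
      innerSL ℂ (fourierBasis B (n + 1) (shift B n q)) from DFunLike.congr_fun h ξ
  refine HilbertBasis.clm_ext (fourierBasis B (n + 1)) fun z => ?_
  obtain ⟨q', rfl⟩ := shift_surjective B n z
  simp only [ContinuousLinearMap.comp_apply, component_apply, innerSL_apply_apply]
  rw [orthonormal_iff_ite.1 (fourierBasis B (n + 1)).orthonormal, fourierBasis_apply B (n + 1),
    coverStep_char, ← fourierBasis_apply]
  by_cases h : q.2 = q'.2
  · rw [if_pos h, orthonormal_iff_ite.1 (fourierBasis B n).orthonormal]
    simp only [(shift_injective B n).eq_iff, Prod.ext_iff, h, and_true]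
  · rw [if_neg h, inner_zero_right, if_neg]
    exact fun h' => h (congrArg Prod.snd (shift_injective B n h'))

/-- The bijection `(z, j) ↦ z - ∑ h, s_h(j_h)` from `ℤ^p × (A ℤ^p / ℤ^p)^n` onto `A^n ℤ^p`. -/
def multiShift : (n : ℕ) → dualLattice B 0 × (Fin n → ZBdual B) → dualLattice B n
  | 0, q => q.1
  | n + 1, q => shift B n (multiShift n (q.1, Fin.init q.2), q.2 (Fin.last n))

lemma multiShift_coe (n : ℕ) (q : dualLattice B 0 × (Fin n → ZBdual B)) :
    (multiShift B n q : Fin p → ℝ) = q.1.1 - ∑ h : Fin n, secLevel B h (q.2 h) := by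
  induction n with
  | zero => simp [multiShift]
  | succ n ih =>
    rw [multiShift, shift_coe, ih, Fin.sum_univ_castSucc, sub_sub]
    rfl

lemma multiShift_injective (n : ℕ) : Function.Injective (multiShift B n) := by
  induction n with
  | zero => exact fun q q' h => Prod.ext h (Subsingleton.elim _ _)
  | succ n ih =>
    intro q q' h
    have h1 := shift_injective B n h
    have h2 := ih (congrArg Prod.fst h1)
    refine Prod.ext (Prod.ext_iff.1 h2).1 ?_
    rw [← Fin.snoc_init_self q.2, ← Fin.snoc_init_self q'.2]
    exact congrArg₂ _ (Prod.ext_iff.1 h2).2 (Prod.ext_iff.1 h1).2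

lemma multiShift_surjective (n : ℕ) : Function.Surjective (multiShift B n) := by
  induction n with
  | zero => exact fun z => ⟨(z, Fin.elim0), rfl⟩
  | succ n ih =>
    intro z
    obtain ⟨⟨y, k⟩, rfl⟩ := shift_surjective B n z
    obtain ⟨⟨x, j⟩, rfl⟩ := ih y
    refine ⟨(x, Fin.snoc j k), ?_⟩
    simp only [multiShift, Fin.init_snoc, Fin.snoc_last]

lemma inner_char_coverMap (n : ℕ) (q : dualLattice B 0 × (Fin n → ZBdual B)) (ξ : L2 B n) :
    inner ℂ (fourierBasis B 0 q.1) (coverMap B n ξ q.2) =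
      inner ℂ (fourierBasis B n (multiShift B n q)) ξ := by
  induction n with
  | zero => rfl
  | succ n ih =>
    rw [multiShift, ← inner_char_coverStep, ← ih]
    rfl

lemma coverV_apply (n : ℕ) (ξ : Spinors B n) (j : Fin n → ZBdual B) (l : Fin (2 ^ (p / 2))) :
    coverV B n ξ j l = coverMap B n (ξ l) j := rfl

lemma inner_char_coverV (n : ℕ) (q : dualLattice B 0 × (Fin n → ZBdual B)) (ξ : Spinors B n)
    (l : Fin (2 ^ (p / 2))) :
    inner ℂ (fourierBasis B 0 q.1) (coverV B n ξ q.2 l) =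
      inner ℂ (fourierBasis B n (multiShift B n q)) (ξ l) :=
  inner_char_coverMap B n q (ξ l)

/-- The image of a basis vector is a basis vector; injectivity of `multiShift` rules out any other
nonzero coefficient. -/
lemma coverV_single (n : ℕ) (q : dualLattice B 0 × (Fin n → ZBdual B)) (l : Fin (2 ^ (p / 2))) :
    coverV B n (WithLp.toLp 2 (Pi.single l (fourierBasis B n (multiShift B n q)))) =
      WithLp.toLp 2 (Pi.single q.2 (WithLp.toLp 2 (Pi.single l (fourierBasis B 0 q.1)))) := by
  classical
  ext j : 1
  refine amp_ext_inner (fourierBasis B 0) fun z m => ?_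
  rw [inner_char_coverV B n (z, j)]
  by_cases hj : j = q.2
  · subst hj
    by_cases hm : m = l
    · subst hm
      simp only [Pi.single_eq_same, orthonormal_iff_ite.1 (fourierBasis B _).orthonormal,
        (multiShift_injective B n).eq_iff, Prod.ext_iff, and_true]
    · simp [hm]
  · by_cases hm : m = l
    · subst hm
      simp only [Pi.single_eq_same, orthonormal_iff_ite.1 (fourierBasis B _).orthonormal,
        (multiShift_injective B n).eq_iff, Prod.ext_iff, hj, and_false, if_false]
      simp [hj]
    · simp [hm, hj]

/-- By surjectivity of `multiShift`, every basis weight on `T_n` is covered by `coverV_single`; the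
coefficients of `V* V ξ` are then read off by moving `V*` onto the basis vector. -/
lemma coverV_adjoint_comp (n : ℕ) :
    (ContinuousLinearMap.adjoint (coverV B n)).comp (coverV B n) =
      ContinuousLinearMap.id ℂ _ := by
  ext1 ξ
  refine amp_ext_inner (fourierBasis B n) fun z l => ?_
  obtain ⟨q, rfl⟩ := multiShift_surjective B n z
  rw [← inner_toLp_single, ContinuousLinearMap.comp_apply,
    ContinuousLinearMap.adjoint_inner_right, coverV_single, inner_toLp_single, inner_toLp_single,
    inner_char_coverV]
  rfl

lemma coverV_comp_adjoint (n : ℕ) :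
    (coverV B n).comp (ContinuousLinearMap.adjoint (coverV B n)) =
      ContinuousLinearMap.id ℂ _ := by
  ext1 η
  ext j : 1
  refine amp_ext_inner (fourierBasis B 0) fun z l => ?_
  rw [ContinuousLinearMap.comp_apply, inner_char_coverV B n (z, j), ← inner_toLp_single,
    ContinuousLinearMap.adjoint_inner_right, coverV_single, inner_toLp_single, inner_toLp_single]
  rfl

end Operators

/-! ### Classical partial derivatives and integration by parts on the torus. -/

section Derivatives

/-- By invariance, `∫ f(t + γ τ)` does not depend on `τ`; differentiating under the integral sign at
`τ = 0` gives `∫ f' = 0`. Invariance also absorbs `γ 0`. -/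
lemma integral_eq_zero_of_hasDerivAt {X : Type*} [TopologicalSpace X] [CompactSpace X]
    [AddGroup X] [IsTopologicalAddGroup X] [MeasurableSpace X] [BorelSpace X] (μ : Measure X)
    [IsFiniteMeasure μ] [μ.IsAddRightInvariant] (f f' : C(X, ℂ)) (γ : ℝ → X)
    (h : ∀ t τ, HasDerivAt (fun τ : ℝ => f (t + γ τ)) (f' (t + γ τ)) τ) :
    ∫ t, f' t ∂μ = 0 := by
  have hcont : ∀ (g : C(X, ℂ)) (u : X), Continuous fun t => g (t + u) := fun g u =>
    g.continuous.comp (continuous_id.add continuous_const)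
  have hd : HasDerivAt (fun τ : ℝ => ∫ t, f (t + γ τ) ∂μ) (∫ t, f' (t + γ 0) ∂μ) 0 := by
    refine (hasDerivAt_integral_of_dominated_loc_of_deriv_le
      (F := fun (τ : ℝ) (t : X) => f (t + γ τ)) (F' := fun (τ : ℝ) (t : X) => f' (t + γ τ))
      (s := Set.univ) (bound := fun _ => ‖f'‖) Filter.univ_mem ?_ ?_ ?_ ?_ ?_ ?_).2
    · exact .of_forall fun τ => (hcont f _).aestronglyMeasurable
    · exact (hcont f _).integrable_of_hasCompactSupport (HasCompactSupport.of_compactSpace _)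
    · exact (hcont f' _).aestronglyMeasurable
    · exact .of_forall fun t τ _ => f'.norm_coe_le_norm _
    · exact integrable_const _
    · exact .of_forall fun t τ _ => h t τ
  have hf := fun u : X => integral_add_right_eq_self (μ := μ) (fun t => f t) u
  have hf' := fun u : X => integral_add_right_eq_self (μ := μ) (fun t => f' t) u
  simp only [hf, hf'] at hd
  exact hd.unique (hasDerivAt_const _ _)

variable {p : ℕ} {B : Matrix (Fin p) (Fin p) ℤ} {n : ℕ} {a : Fin p}

lemma IsPartial.hasDerivAt {f f' : Torus B n → ℂ} (h : IsPartial B a f f') (t : Torus B n) (τ : ℝ) :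
    HasDerivAt (fun τ : ℝ => f (t + toTorus B n (τ • Pi.single a 1)))
      (f' (t + toTorus B n (τ • Pi.single a 1))) τ := by
  have h1 := h (t + toTorus B n (τ • Pi.single a 1))
  have h2 := HasDerivAt.comp_sub_const (x := τ) τ (by rwa [sub_self])
    (f := fun σ : ℝ => f (t + toTorus B n (τ • Pi.single a 1) + toTorus B n (σ • Pi.single a 1)))
    (f' := f' (t + toTorus B n (τ • Pi.single a 1)))
  convert! h2 using 3 with σ
  rw [add_assoc, ← map_add, ← add_smul, add_sub_cancel]

lemma IsPartial.mul {f f' g g' : C(Torus B n, ℂ)} (hf : IsPartial B a f f')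
    (hg : IsPartial B a g g') : IsPartial B a (f * g : C(Torus B n, ℂ)) (f' * g + f * g' : C(_, ℂ)) :=
  fun x => by simpa using! (hf x).mul (hg x)

lemma IsPartial.star {f f' : C(Torus B n, ℂ)} (hf : IsPartial B a f f') :
    IsPartial B a (star f : C(Torus B n, ℂ)) (star f' : C(_, ℂ)) :=
  fun x => (hf x).star

lemma isQuotientMap_toTorus : Topology.IsQuotientMap (toTorus B n) := isQuotientMap_quotient_mk'

lemma IsOfClass.exists_isPartial {f : C(Torus B n, ℂ)} (hf : IsOfClass B 1 f) (a : Fin p) :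
    ∃ f' : C(Torus B n, ℂ), IsPartial B a f f' := by
  let F : (Fin p → ℝ) → ℂ := fun t => f (toTorus B n t)
  have hF : ContDiff ℝ 1 F := hf
  have hd : ∀ x, HasDerivAt (fun τ : ℝ => f (toTorus B n x + toTorus B n (τ • Pi.single a 1)))
      (fderiv ℝ F x (Pi.single a 1)) 0 := fun x => by
    have h1 : HasFDerivAt F (fderiv ℝ F x) (x + (0 : ℝ) • Pi.single a 1) := by
      simpa using (hF.differentiable one_ne_zero x).hasFDerivAt
    have h2 : HasDerivAt (fun τ : ℝ => x + τ • (Pi.single a 1 : Fin p → ℝ)) (Pi.single a 1) 0 := by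
      simpa using! ((hasDerivAt_id (0 : ℝ)).smul_const (Pi.single a 1 : Fin p → ℝ)).const_add x
    have h3 := h1.comp_hasDerivAt (0 : ℝ) h2
    convert! h3 using 2 with τ
  refine ⟨⟨fun t => deriv (fun τ : ℝ => f (t + toTorus B n (τ • Pi.single a 1))) 0, ?_⟩, ?_⟩
  -- Continuity on the torus is continuity of the lift to `ℝ^p`, where the function is a value of
  -- the continuous `fderiv`.
  · rw [isQuotientMap_toTorus.continuous_iff]
    have h : (fun t => deriv (fun τ : ℝ => f (t + toTorus B n (τ • Pi.single a 1))) 0) ∘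
        toTorus B n = fun x => fderiv ℝ F x (Pi.single a 1) := funext fun x => (hd x).deriv
    rw [h]
    exact (hF.continuous_fderiv one_ne_zero).clm_apply continuous_const
  · intro t
    obtain ⟨x, rfl⟩ := toTorus_surjective B n t
    exact (hd x).differentiableAt.hasDerivAt

variable [hB : Fact (1 < |B.det|)]

lemma isOfClass_char (m : WithTop ℕ∞) (z : dualLattice B n) : IsOfClass B m (char B n z) := by
  have h : ContDiff ℝ m fun t : Fin p → ℝ => dotProduct z.1 t := by
    unfold dotProduct
    fun_prop
  exact (contDiff_const.mul (Complex.ofRealCLM.contDiff.comp h)).cexp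

lemma isPartial_char (a : Fin p) (z : dualLattice B n) : IsPartial B a (char B n z)
    ((2 * Real.pi * Complex.I * (z.1 a : ℂ)) • char B n z : C(Torus B n, ℂ)) := by
  intro t
  have h : ∀ τ : ℝ, char B n z (toTorus B n (τ • Pi.single a 1)) =
      Complex.exp (2 * Real.pi * Complex.I * (z.1 a : ℂ) * (τ : ℂ)) := fun τ => by
    rw [char_toTorus, dotProduct_smul, dotProduct_single_one]
    congr 1
    push_cast [smul_eq_mul]
    ring
  simp only [char_apply_add, h, ContinuousMap.smul_apply, smul_eq_mul]
  have h1 : HasDerivAt (fun τ : ℝ => 2 * Real.pi * Complex.I * (z.1 a : ℂ) * (τ : ℂ))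
      (2 * Real.pi * Complex.I * (z.1 a : ℂ)) 0 := by
    simpa using (Complex.ofRealCLM.hasDerivAt (x := (0 : ℝ))).const_mul
      (2 * Real.pi * Complex.I * (z.1 a : ℂ))
  convert! h1.cexp.const_mul (char B n z t) using 1
  simp [mul_comm]

lemma integral_eq_zero_of_isPartial {f f' : C(Torus B n, ℂ)} (h : IsPartial B a f f') :
    ∫ t, f' t ∂haar B n = 0 :=
  integral_eq_zero_of_hasDerivAt (haar B n) f f' (fun τ => toTorus B n (τ • Pi.single a 1))
    h.hasDerivAt

lemma inner_toL2 (f g : C(Torus B n, ℂ)) :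
    inner ℂ (toL2 B n f) (toL2 B n g) = ∫ t, (star f * g) t ∂haar B n := by
  rw [toL2, toL2, ContinuousMap.inner_toLp]
  simp [mul_comm]

/-- Integration by parts: the partial derivative of `conj f · ⟨z, ·⟩` has integral zero. -/
lemma inner_toL2_char_of_isPartial {f f' : C(Torus B n, ℂ)} (h : IsPartial B a f f')
    (z : dualLattice B n) : inner ℂ (toL2 B n f') (fourierBasis B n z) =
      - ((2 * Real.pi * Complex.I * (z.1 a : ℂ)) * inner ℂ (toL2 B n f) (fourierBasis B n z)) := by
  have h1 := integral_eq_zero_of_isPartial (h.star.mul (isPartial_char a z))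
  have hint : ∀ g : C(Torus B n, ℂ), Integrable g (haar B n) := fun g =>
    g.continuous.integrable_of_hasCompactSupport (HasCompactSupport.of_compactSpace _)
  simp only [ContinuousMap.add_apply] at h1
  rw [integral_add (hint _) (hint _)] at h1
  rw [fourierBasis_apply, ← inner_smul_right, ← map_smul, inner_toL2, inner_toL2]
  exact eq_neg_of_add_eq_zero_left h1

end Derivatives

/-! ### The weak partial derivatives as Fourier multipliers. -/

section WeakPartial

variable {p : ℕ} (B : Matrix (Fin p) (Fin p) ℤ) [hB : Fact (1 < |B.det|)] {n : ℕ} {a : Fin p}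

lemma inner_fourierBasis_of_mem_weakPartialGraph {ξ η : L2 B n}
    (h : (ξ, η) ∈ weakPartialGraph B n a) (z : dualLattice B n) :
    inner ℂ (fourierBasis B n z) η =
      (2 * Real.pi * Complex.I * (z.1 a : ℂ)) * inner ℂ (fourierBasis B n z) ξ := by
  have h1 := h _ _ (isOfClass_char ∞ z) (isPartial_char a z)
  rw [map_smul, inner_smul_left] at h1
  rw [fourierBasis_apply, ← neg_eq_iff_eq_neg.2 h1]
  simp [Complex.conj_ofNat]

/-- Parseval's formula reduces the identity to characters. The function `f` needs only a continuous
partial derivative, not smoothness, which the Leibniz rule for `C¹` multipliers relies on. -/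
lemma inner_toL2_of_isPartial {ξ η : L2 B n}
    (h : ∀ z, inner ℂ (fourierBasis B n z) η =
      (2 * Real.pi * Complex.I * (z.1 a : ℂ)) * inner ℂ (fourierBasis B n z) ξ)
    {f f' : C(Torus B n, ℂ)} (hf : IsPartial B a f f') :
    inner ℂ (toL2 B n f') ξ = - inner ℂ (toL2 B n f) η := by
  have h1 := (fourierBasis B n).hasSum_inner_mul_inner (toL2 B n f') ξ
  have h2 := ((fourierBasis B n).hasSum_inner_mul_inner (toL2 B n f) η).neg
  refine h1.unique (h2.congr_fun fun z => ?_)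
  rw [inner_toL2_char_of_isPartial hf, h z]
  ring

lemma mem_weakPartialGraph_iff {ξ η : L2 B n} : (ξ, η) ∈ weakPartialGraph B n a ↔
    ∀ z, inner ℂ (fourierBasis B n z) η =
      (2 * Real.pi * Complex.I * (z.1 a : ℂ)) * inner ℂ (fourierBasis B n z) ξ :=
  ⟨inner_fourierBasis_of_mem_weakPartialGraph B,
    fun h _ _ _ hf' => inner_toL2_of_isPartial B h hf'⟩

/-- Single-valuedness of the graph, without which `Submodule.toLinearPMap` would not return an
operator with this graph. -/
lemma weakPartialGraph_functional : ∀ q ∈ weakPartialGraph B n a, q.1 = 0 → q.2 = 0 := by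
  rintro ⟨ξ, η⟩ h h0
  simp only at h0
  subst h0
  refine HilbertBasis.ext_inner (fourierBasis B n) fun z => ?_
  rw [inner_fourierBasis_of_mem_weakPartialGraph B h]
  simp

lemma weakPartial_mem (ξ : (weakPartial B n a).domain) :
    ((ξ : L2 B n), weakPartial B n a ξ) ∈ weakPartialGraph B n a :=
  Submodule.mem_graph_toLinearPMap (weakPartialGraph_functional B) ξ

lemma exists_weakPartial_eq {ξ η : L2 B n} (h : (ξ, η) ∈ weakPartialGraph B n a) :
    ∃ hξ : ξ ∈ (weakPartial B n a).domain, weakPartial B n a ⟨ξ, hξ⟩ = η := by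
  rw [← Submodule.toLinearPMap_graph_eq _ (weakPartialGraph_functional B),
    LinearPMap.mem_graph_iff] at h
  obtain ⟨y, hy, hy'⟩ := h
  simp only at hy hy'
  subst hy
  exact ⟨y.2, hy'⟩

lemma inner_mulOp (f : C(Torus B n, ℂ)) (ξ η : L2 B n) :
    inner ℂ ξ (mulOp B n f η) = inner ℂ (mulOp B n (star f) ξ) η := by
  rw [L2.inner_def, L2.inner_def]
  refine integral_congr_ae ?_
  filter_upwards [coeFn_mulOp B n f η, coeFn_mulOp B n (star f) ξ] with t h1 h2
  rw [h1, h2]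
  simp
  ring

/-- The Leibniz rule. -/
lemma mulOp_mem_weakPartialGraph {f f' : C(Torus B n, ℂ)} (hf : IsPartial B a f f') {ξ η : L2 B n}
    (h : (ξ, η) ∈ weakPartialGraph B n a) :
    (mulOp B n f ξ, mulOp B n f η + mulOp B n f' ξ) ∈ weakPartialGraph B n a := by
  intro g g' _ hg'
  -- The product `star f * g` need not be smooth, hence need not be admissible in the definition of
  -- the weak derivative; the Fourier characterisation allows it.
  have h1 := inner_toL2_of_isPartial B ((mem_weakPartialGraph_iff B).1 h) (hf.star.mul hg')
  have h2 : ∀ g f : C(Torus B n, ℂ), ∀ ξ : L2 B n,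
      inner ℂ (toL2 B n g) (mulOp B n f ξ) = inner ℂ (toL2 B n (star f * g)) ξ := fun g f ξ => by
    rw [inner_mulOp, mulOp_toL2]
  have h3 : toL2 B n (star f' * g + star f * g') =
      toL2 B n (star f' * g) + toL2 B n (star f * g') := map_add _ _ _
  rw [h3, inner_add_left] at h1
  simp only [inner_add_right, h2]
  linear_combination h1

end WeakPartial

/-! ### Diagonal matrices in tensor slots. -/

section Matrices

lemma inSlot_diagonal {n : ℕ} {J : Type*} [DecidableEq J] (h : Fin n) (d : J → ℂ) :
    inSlot h (Matrix.diagonal d) = Matrix.diagonal fun j : Fin n → J => d (j h) := by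
  ext j k
  rw [inSlot, tensorMatrix, Matrix.diagonal_apply]
  split_ifs with hjk
  · subst hjk
    rw [Finset.prod_eq_single h]
    · simp
    · intro i _ hi
      simp [Function.update_of_ne hi]
    · simp
  · obtain ⟨i, hi⟩ := Function.ne_iff.1 hjk
    refine Finset.prod_eq_zero (Finset.mem_univ i) ?_
    by_cases hih : i = h
    · subst hih
      simp [hi]
    · simp [Function.update_of_ne hih, hi]

lemma sum_inSlot_diagonal {n : ℕ} {J : Type*} [DecidableEq J] (d : Fin n → J → ℂ) :
    ∑ h, inSlot h (Matrix.diagonal (d h)) =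
      Matrix.diagonal fun j : Fin n → J => ∑ h, d h (j h) := by
  simp only [inSlot_diagonal]
  ext j k
  rw [Matrix.sum_apply]
  by_cases hjk : j = k
  · simp [hjk]
  · simp [Matrix.diagonal_apply_ne _ hjk]

end Matrices

/-! ### The formula for the conjugated Dirac operator. -/

section Dirac

variable {p : ℕ} (B : Matrix (Fin p) (Fin p) ℤ) [hB : Fact (1 < |B.det|)] (n : ℕ)
  (ε : Fin p → Matrix (Fin (2 ^ (p / 2))) (Fin (2 ^ (p / 2))) ℂ)

lemma mem_dirac_domain {ξ : Spinors B n} :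
    ξ ∈ (dirac B ε n).domain ↔ ∀ a l, ξ l ∈ (weakPartial B n a).domain :=
  Submodule.mem_iInf _

lemma cliffordMul_apply (M : Matrix (Fin (2 ^ (p / 2))) (Fin (2 ^ (p / 2))) ℂ) (ξ : Spinors B n)
    (l : Fin (2 ^ (p / 2))) : cliffordMul B n M ξ l = ∑ m, M l m • ξ m :=
  opTensor_apply _ _ _ _

lemma dirac_apply (ξ : Spinors B n) (hξ : ξ ∈ (dirac B ε n).domain) :
    dirac B ε n ⟨ξ, hξ⟩ = (-Complex.I) • ∑ a, cliffordMul B n (ε a) (WithLp.toLp 2 fun l =>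
      weakPartial B n a ⟨ξ l, (mem_dirac_domain B n ε).1 hξ a l⟩) := by
  change ((-Complex.I) • ∑ a, (cliffordMul B n (ε a) : Spinors B n →ₗ[ℂ] Spinors B n) ∘ₗ
    (amplify (Fin (2 ^ (p / 2))) (weakPartial B n a)).toFun ∘ₗ
      Submodule.inclusion (iInf_le _ a)) ⟨ξ, hξ⟩ = _
  rw [LinearMap.smul_apply, LinearMap.sum_apply]
  rfl

/-- If `∂^a ξ_l = ζ^a_l` for all `a` and `l`, then `ξ` is in the domain of the Dirac operator. -/
lemma exists_dirac_eq {ξ : Spinors B n} {ζ : Fin p → Spinors B n}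
    (h : ∀ a l, (ξ l, ζ a l) ∈ weakPartialGraph B n a) :
    ∃ hξ : ξ ∈ (dirac B ε n).domain,
      dirac B ε n ⟨ξ, hξ⟩ = (-Complex.I) • ∑ a, cliffordMul B n (ε a) (ζ a) := by
  have hξ : ξ ∈ (dirac B ε n).domain :=
    (mem_dirac_domain B n ε).2 fun a l => (exists_weakPartial_eq B (h a l)).1
  refine ⟨hξ, ?_⟩
  rw [dirac_apply]
  refine congrArg _ (Finset.sum_congr rfl fun a _ => congrArg _ ?_)
  ext l : 1
  exact (exists_weakPartial_eq B (h a l)).2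

lemma exists_weakPartials {ξ : Spinors B n} (hξ : ξ ∈ (dirac B ε n).domain) :
    ∃ ζ : Fin p → Spinors B n, (∀ a l, (ξ l, ζ a l) ∈ weakPartialGraph B n a) ∧
      dirac B ε n ⟨ξ, hξ⟩ = (-Complex.I) • ∑ a, cliffordMul B n (ε a) (ζ a) :=
  ⟨_, fun a l => weakPartial_mem B ⟨ξ l, (mem_dirac_domain B n ε).1 hξ a l⟩, dirac_apply B n ε ξ hξ⟩

lemma coverV_cliffordMul (M : Matrix (Fin (2 ^ (p / 2))) (Fin (2 ^ (p / 2))) ℂ)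
    (ξ : Spinors B n) (j : Fin n → ZBdual B) :
    coverV B n (cliffordMul B n M ξ) j = cliffordMul B 0 M (coverV B n ξ j) := by
  ext l : 1
  rw [coverV_apply, cliffordMul_apply, cliffordMul_apply, map_sum]
  simp only [map_smul, coverV_apply, WithLp.ofLp_sum, WithLp.ofLp_smul, Finset.sum_apply,
    Pi.smul_apply]

/-- The sum `∑ h, s_h(j_h)` of the sections along the multi-index `j`. -/
def secSum (j : Fin n → ZBdual B) : Fin p → ℝ := ∑ h : Fin n, secLevel B h (j h)

/-- The coefficient of weight `z` in the component `j` of `V ξ` is that of weight `z - secSum j` in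
`ξ`. So `V ∂^a V*` acts on that component as `∂^a - 2πi (secSum j)_a`, and the equivalence keeps
track of domains in both directions. -/
lemma weakPartialGraph_coverV (a : Fin p) (ξ ζ : Spinors B n) :
    (∀ l, (ξ l, ζ l) ∈ weakPartialGraph B n a) ↔
      ∀ j l, (coverV B n ξ j l, coverV B n ζ j l +
        (2 * Real.pi * Complex.I * (secSum B n j a : ℂ)) • coverV B n ξ j l) ∈
          weakPartialGraph B 0 a := by
  simp only [mem_weakPartialGraph_iff, inner_add_right, inner_smul_right]
  have key : ∀ (z : dualLattice B 0) (j : Fin n → ZBdual B) l,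
      (inner ℂ (fourierBasis B n (multiShift B n (z, j))) (ζ l) =
        2 * Real.pi * Complex.I * ((multiShift B n (z, j)).1 a : ℂ) *
          inner ℂ (fourierBasis B n (multiShift B n (z, j))) (ξ l)) ↔
      inner ℂ (fourierBasis B 0 z) (coverV B n ζ j l) +
        2 * Real.pi * Complex.I * (secSum B n j a : ℂ) *
          inner ℂ (fourierBasis B 0 z) (coverV B n ξ j l) =
        2 * Real.pi * Complex.I * (z.1 a : ℂ) *
          inner ℂ (fourierBasis B 0 z) (coverV B n ξ j l) := fun z j l => by
    rw [inner_char_coverV B n (z, j), inner_char_coverV B n (z, j), multiShift_coe,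
      ← eq_sub_iff_add_eq, secSum]
    simp only [Pi.sub_apply, Complex.ofReal_sub, mul_sub, sub_mul]
  constructor
  · exact fun h j l z => (key z j l).1 (h l _)
  · intro h l z
    obtain ⟨⟨z, j⟩, rfl⟩ := multiShift_surjective B n z
    exact (key z j l).2 (h j l z)

lemma sectionOp_apply (η : BaseSpinors B n) (j : Fin n → ZBdual B) :
    sectionOp B ε n η j = ∑ a, (secSum B n j a : ℂ) • cliffordMul B 0 (ε a) (η j) := by
  simp only [sectionOp, _root_.sum_apply, WithLp.ofLp_sum, Finset.sum_apply, opTensor_apply,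
    sum_inSlot_diagonal (fun (h : Fin n) (k : ZBdual B) => ((secLevel B h k _ : ℝ) : ℂ))]
  refine Finset.sum_congr rfl fun a _ => ?_
  rw [Finset.sum_eq_single j]
  · simp [secSum]
  · intro k _ hk
    rw [Matrix.diagonal_apply_ne _ hk.symm, zero_smul]
  · simp

lemma coverV_adjoint_apply (η : BaseSpinors B n) :
    coverV B n (ContinuousLinearMap.adjoint (coverV B n) η) = η :=
  DFunLike.congr_fun (coverV_comp_adjoint B n) η

lemma adjoint_coverV_apply (ξ : Spinors B n) :
    ContinuousLinearMap.adjoint (coverV B n) (coverV B n ξ) = ξ :=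
  DFunLike.congr_fun (coverV_adjoint_comp B n) ξ

/-- The formula for `V_n D_n V_n*`. -/
lemma diracHat_eq : diracHat B ε n = amplify (Fin n → ZBdual B) (dirac B ε 0) -
    ((2 * Real.pi : ℂ) • (sectionOp B ε n).toLinearMap).toPMap ⊤ := by
  -- One inclusion of domains, together with the formula on each component.
  have h1 : ∀ (ξ : Spinors B n) (hξ : ξ ∈ (dirac B ε n).domain), ∀ j,
      ∃ h : coverV B n ξ j ∈ (dirac B ε 0).domain, coverV B n (dirac B ε n ⟨ξ, hξ⟩) j =
        dirac B ε 0 ⟨coverV B n ξ j, h⟩ -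
          (2 * Real.pi : ℂ) • sectionOp B ε n (coverV B n ξ) j := by
    intro ξ hξ j
    obtain ⟨ζ, hζ, hD⟩ := exists_weakPartials B n ε hξ
    obtain ⟨h, h'⟩ := exists_dirac_eq B 0 ε (ξ := coverV B n ξ j) (ζ := fun a =>
      coverV B n (ζ a) j + (2 * Real.pi * Complex.I * (secSum B n j a : ℂ)) • coverV B n ξ j)
      fun a l => (weakPartialGraph_coverV B n a ξ (ζ a)).1 (hζ a) j l
    refine ⟨h, ?_⟩
    rw [hD, h', map_smul, map_sum]
    simp only [WithLp.ofLp_sum, WithLp.ofLp_smul, Finset.sum_apply, Pi.smul_apply,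
      coverV_cliffordMul, map_add, map_smul, sectionOp_apply, Finset.sum_add_distrib,
      Finset.smul_sum, smul_add, smul_smul, sub_eq_add_neg, add_assoc, left_eq_add]
    rw [← sub_eq_add_neg, sub_eq_zero]
    refine Finset.sum_congr rfl fun a _ => ?_
    congr 1
    linear_combination (-2 * Real.pi * (secSum B n j a : ℂ)) * Complex.I_sq
  have h2 : ∀ ξ : Spinors B n, (∀ j, coverV B n ξ j ∈ (dirac B ε 0).domain) →
      ξ ∈ (dirac B ε n).domain := by
    intro ξ hξ
    refine (mem_dirac_domain B n ε).2 fun a l => ?_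
    have hm := fun j => (mem_dirac_domain B 0 ε).1 (hξ j) a
    -- For the other inclusion, `η` is what `V ∂^a ξ` has to be; `V* η` then serves as the weak
    -- derivative of `ξ`.
    let η : BaseSpinors B n := WithLp.toLp 2 fun j => WithLp.toLp 2 fun l =>
      weakPartial B 0 a ⟨coverV B n ξ j l, hm j l⟩ -
        (2 * Real.pi * Complex.I * (secSum B n j a : ℂ)) • coverV B n ξ j l
    refine (exists_weakPartial_eq B ((weakPartialGraph_coverV B n a ξ
      (ContinuousLinearMap.adjoint (coverV B n) η)).2 (fun j m => ?_) l)).1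
    rw [coverV_adjoint_apply]
    simpa [η] using weakPartial_mem B ⟨coverV B n ξ j m, hm j m⟩
  refine LinearPMap.ext ?_ ?_
  · ext η
    obtain ⟨ξ, rfl⟩ : ∃ ξ, coverV B n ξ = η := ⟨_, coverV_adjoint_apply B n η⟩
    change ContinuousLinearMap.adjoint (coverV B n) (coverV B n ξ) ∈ (dirac B ε n).domain ↔ _ ∧ True
    rw [adjoint_coverV_apply, and_true]
    exact ⟨fun h j => (h1 ξ h j).1, h2 ξ⟩
  · intro η hf hg
    obtain ⟨ξ, rfl⟩ : ∃ ξ, coverV B n ξ = η := ⟨_, coverV_adjoint_apply B n η⟩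
    have hξ : ξ ∈ (dirac B ε n).domain := by
      have : ContinuousLinearMap.adjoint (coverV B n) (coverV B n ξ) ∈ (dirac B ε n).domain := hf
      rwa [adjoint_coverV_apply] at this
    have h3 : diracHat B ε n ⟨coverV B n ξ, hf⟩ = coverV B n (dirac B ε n ⟨ξ, hξ⟩) := by
      change coverV B n (dirac B ε n ⟨_, _⟩) = _
      congr 3
      exact adjoint_coverV_apply B n ξ
    rw [h3, LinearPMap.sub_apply]
    ext j : 1
    exact (h1 ξ hξ j).2

end Dirac

/-! ### Operators diagonal in a Hilbert basis. -/

section Diagonal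

variable {ι K : Type*} [NormedAddCommGroup K] [InnerProductSpace ℂ K]

/-- The operator `T` is diagonal with eigenvalues `ν` in the Hilbert basis `b`. -/
def IsDiag (b : HilbertBasis ι ℂ K) (ν : ι → ℂ) (T : K →L[ℂ] K) : Prop :=
  ∀ i ξ, inner ℂ (b i) (T ξ) = ν i * inner ℂ (b i) ξ

lemma HilbertBasis.hasSum_norm_sq (b : HilbertBasis ι ℂ K) (ξ : K) :
    HasSum (fun i => ‖(inner ℂ (b i) ξ : ℂ)‖ ^ 2) (‖ξ‖ ^ 2) := by
  have h := b.hasSum_inner_mul_inner ξ ξ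
  rw [inner_self_eq_norm_sq_to_K] at h
  have h2 := Complex.hasSum_re h
  convert! h2 using 1
  · funext i
    rw [← inner_conj_symm ξ, mul_comm, Complex.mul_conj, Complex.normSq_eq_norm_sq,
      Complex.ofReal_re]
  · norm_cast

lemma IsDiag.norm_le {b : HilbertBasis ι ℂ K} {ν : ι → ℂ} {T : K →L[ℂ] K} (hT : IsDiag b ν T)
    {C : ℝ} (hC : 0 ≤ C) (hν : ∀ i, ‖ν i‖ ≤ C) : ‖T‖ ≤ C := by
  refine T.opNorm_le_bound hC fun ξ => ?_
  refine le_of_sq_le_sq ?_ (by positivity)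
  rw [mul_pow]
  refine hasSum_le (fun i => ?_) (HilbertBasis.hasSum_norm_sq b (T ξ))
    ((HilbertBasis.hasSum_norm_sq b ξ).mul_left (C ^ 2))
  rw [hT, norm_mul, mul_pow]
  gcongr
  exact hν i

lemma exists_isDiag (b : HilbertBasis ι ℂ K) {ν : ι → ℂ} {C : ℝ} (hν : ∀ i, ‖ν i‖ ≤ C) :
    ∃ T : K →L[ℂ] K, IsDiag b ν T := by
  -- An index is needed to know that `C` is nonnegative.
  by_cases hι : Nonempty ι
  · have hC : 0 ≤ C := (norm_nonneg _).trans (hν hι.some)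
    have hmem : ∀ ξ, Memℓp (fun i => ν i * b.repr ξ i) 2 := fun ξ => by
      refine ((lp.memℓp (b.repr ξ)).const_smul (C : ℂ)).mono' fun i => ?_
      simp only [Pi.smul_apply, norm_mul, smul_eq_mul, Complex.norm_real, Real.norm_of_nonneg hC]
      gcongr
      exact hν i
    let T : K →ₗ[ℂ] K := b.repr.symm.toLinearEquiv.toLinearMap ∘ₗ
      { toFun := fun ξ => (⟨fun i => ν i * b.repr ξ i, hmem ξ⟩ : lp (fun _ : ι => ℂ) 2)
        map_add' := fun x y => by
          ext i
          simp only [map_add, lp.coeFn_add, Pi.add_apply, mul_add]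
        map_smul' := fun c x => by
          ext i
          simp [mul_left_comm] }
    have hT : ∀ i ξ, inner ℂ (b i) (T ξ) = ν i * inner ℂ (b i) ξ := fun i ξ => by
      rw [← b.repr_apply_apply, ← b.repr_apply_apply]
      simp [T]
    refine ⟨T.mkContinuous C fun ξ => ?_, hT⟩
    refine le_of_sq_le_sq ?_ (by positivity)
    rw [mul_pow]
    refine hasSum_le (fun i => ?_) (HilbertBasis.hasSum_norm_sq b (T ξ))
      ((HilbertBasis.hasSum_norm_sq b ξ).mul_left (C ^ 2))
    rw [hT, norm_mul, mul_pow]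
    gcongr
    exact hν i
  · exact ⟨0, fun i => (hι ⟨i⟩).elim⟩

lemma isCompactOperator_smulRight (f : K →L[ℂ] ℂ) (x : K) :
    IsCompactOperator (f.smulRight x) := by
  have h : IsCompactOperator ((ContinuousLinearMap.id ℂ ℂ).smulRight x) :=
    isCompactOperator_of_locallyCompactSpace_rng _
  exact h.comp_clm f

/-- Only finitely many eigenvalues have modulus at least `δ / 2`. Cutting off the others leaves a
finite-rank operator at distance at most `δ / 2`, and compact operators are norm-closed. -/
lemma IsDiag.isCompactOperator [CompleteSpace K] {b : HilbertBasis ι ℂ K} {ν : ι → ℂ}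
    {T : K →L[ℂ] K} (hT : IsDiag b ν T) (hν : Filter.Tendsto ν Filter.cofinite (nhds 0)) :
    IsCompactOperator T := by
  classical
  suffices h : T ∈ (compactOperator (RingHom.id ℂ) K K).topologicalClosure by
    rwa [compactOperator_topologicalClosure] at h
  refine Metric.mem_closure_iff.2 fun δ hδ => ?_
  have hfin : {i | ¬ ‖ν i‖ < δ / 2}.Finite := by
    have := hν.norm.eventually (gt_mem_nhds (by simpa using half_pos hδ : ‖(0 : ℂ)‖ < δ / 2))
    exact Filter.eventually_cofinite.1 this
  let S : K →L[ℂ] K := ∑ i ∈ hfin.toFinset, (innerSL ℂ (b i)).smulRight (ν i • b i)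
  refine ⟨S, Submodule.sum_mem _ fun i _ => isCompactOperator_smulRight _ _, ?_⟩
  have hd : IsDiag b (fun i => if ‖ν i‖ < δ / 2 then ν i else 0) (T - S) := by
    intro i ξ
    have h1 : inner ℂ (b i) (S ξ) = if ‖ν i‖ < δ / 2 then 0 else ν i * inner ℂ (b i) ξ := by
      simp only [S, _root_.sum_apply, ContinuousLinearMap.smulRight_apply, inner_sum,
        inner_smul_right, innerSL_apply_apply, orthonormal_iff_ite.1 b.orthonormal]
      by_cases h : ‖ν i‖ < δ / 2
      · rw [if_pos h]
        refine Finset.sum_eq_zero fun k hk => ?_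
        have hki : i ≠ k := by
          rintro rfl
          exact (hfin.mem_toFinset.1 hk) h
        simp [hki]
      · rw [if_neg h, Finset.sum_eq_single i]
        · simp [mul_comm]
        · intro k _ hk
          simp [hk.symm]
        · exact fun h' => (h' (hfin.mem_toFinset.2 h)).elim
    rw [_root_.sub_apply, inner_sub_right, hT, h1]
    by_cases h : ‖ν i‖ < δ / 2
    · simp only [if_pos h, sub_zero]
    · simp only [if_neg h, sub_self, zero_mul]
  rw [dist_eq_norm]
  refine (hd.norm_le (half_pos hδ).le fun i => ?_).trans_lt (half_lt_self hδ)
  split_ifs with h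
  · exact h.le
  · simpa using (half_pos hδ).le

lemma isCompactOperator_opTensor {J : Type*} [Fintype J] {S : K →L[ℂ] K}
    (hS : IsCompactOperator S) (M : Matrix J J ℂ) : IsCompactOperator (opTensor S M) := by
  classical
  let e : J → K →L[ℂ] Amp J K := fun j =>
    tuple fun i => if i = j then ContinuousLinearMap.id ℂ K else 0
  have h : opTensor S M = ∑ j, ∑ k, M j k • (e j).comp (S.comp (component k)) := by
    ext ξ i
    have he : ∀ (j : J) (x : K), e j x i = if i = j then x else 0 := fun j x => by
      by_cases hij : i = j <;> simp [e, tuple_apply, hij]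
    simp [opTensor_apply, component_apply, he]
  rw [h]
  refine Submodule.sum_mem (compactOperator (RingHom.id ℂ) (Amp J K) (Amp J K)) fun j _ =>
    Submodule.sum_mem _ fun k _ => Submodule.smul_mem _ _ ?_
  exact (hS.comp_clm (component k)).clm_comp (e j)

end Diagonal

/-! ### Self-adjointness from symmetry and resolvents. -/

section SelfAdjoint

variable {K : Type*} [NormedAddCommGroup K] [InnerProductSpace ℂ K]

/-- A densely defined symmetric operator with compact resolvent is self-adjoint. -/
lemma isSelfAdjoint_of_hasCompactResolvent [CompleteSpace K] {D : K →ₗ.[ℂ] K}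
    (hd : Dense (D.domain : Set K)) (hs : D.IsFormalAdjoint D) (hr : HasCompactResolvent D) :
    IsSelfAdjoint D := by
  have hle : D ≤ D.adjoint := hs.le_adjoint hd
  rw [LinearPMap.isSelfAdjoint_def]
  refine (LinearPMap.eq_of_le_of_domain_eq hle (le_antisymm hle.1 fun y hy => ?_)).symm
  obtain ⟨R, -, hR, -⟩ := hr Complex.I (by simp)
  obtain ⟨R', -, hR', -⟩ := hr (-Complex.I) (by simp)
  -- Choose `ξ ∈ dom D` with `(D - i) ξ = (D* - i) y`; then `y - ξ` is orthogonal to the range of `D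
  -- + i`.
  obtain ⟨h1, h2⟩ := hR (D.adjoint ⟨y, hy⟩ - Complex.I • y)
  set ξ := R (D.adjoint ⟨y, hy⟩ - Complex.I • y)
  have hadj := LinearPMap.adjoint_isFormalAdjoint hd
  have h3 : ∀ x : D.domain, inner ℂ (y - ξ) (D x + Complex.I • (x : K)) = 0 := fun x => by
    have e1 := hadj ⟨y, hy⟩ x
    have e2 := hs ⟨ξ, h1⟩ x
    simp only at e1 e2
    rw [inner_sub_left, inner_add_right, inner_add_right, ← e1, ← e2, inner_smul_right,
      inner_smul_right]
    have h4 : D.adjoint ⟨y, hy⟩ = D ⟨ξ, h1⟩ - Complex.I • ξ + Complex.I • y := by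
      rw [h2, sub_add_cancel]
    rw [h4, inner_add_left, inner_sub_left, inner_smul_left, inner_smul_left, Complex.conj_I]
    ring
  -- Since `D + i` is onto, `y - ξ` lies in that range, so it is orthogonal to itself.
  obtain ⟨h4, h5⟩ := hR' (y - ξ)
  have h6 := h3 ⟨_, h4⟩
  rw [neg_smul, sub_neg_eq_add] at h5
  rw [h5, inner_self_eq_zero, sub_eq_zero] at h6
  rw [h6]
  exact h1

end SelfAdjoint

/-! ### Transport of spectral triples along a unitary. -/

section Conjugation

variable {K : Type*} [NormedAddCommGroup K] [InnerProductSpace ℂ K] [CompleteSpace K]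
variable {K' : Type*} [NormedAddCommGroup K'] [InnerProductSpace ℂ K'] [CompleteSpace K']

/-- The representation `a ↦ V ρ(a) V*`, for a unitary `V`. -/
def conjRep {A : Type*} [CStarAlgebra A] (V : K →L[ℂ] K')
    (h₁ : (ContinuousLinearMap.adjoint V).comp V = ContinuousLinearMap.id ℂ K)
    (h₂ : V.comp (ContinuousLinearMap.adjoint V) = ContinuousLinearMap.id ℂ K')
    (ρ : A →⋆ₐ[ℂ] (K →L[ℂ] K)) : A →⋆ₐ[ℂ] (K' →L[ℂ] K') where
  toFun a := V.comp ((ρ a).comp (ContinuousLinearMap.adjoint V))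
  map_one' := by
    rw [map_one]
    exact h₂
  map_mul' a a' := by
    ext ξ
    have h : ∀ η, ContinuousLinearMap.adjoint V (V η) = η := DFunLike.congr_fun h₁
    simp [h]
  map_zero' := by simp
  map_add' a a' := by
    ext ξ
    simp
  commutes' c := by
    ext ξ
    have h : ∀ η, V (ContinuousLinearMap.adjoint V η) = η := DFunLike.congr_fun h₂
    simp [Algebra.algebraMap_eq_smul_one, h]
  map_star' a := by
    rw [map_star, ContinuousLinearMap.star_eq_adjoint, ContinuousLinearMap.star_eq_adjoint,
      ContinuousLinearMap.adjoint_comp, ContinuousLinearMap.adjoint_comp,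
      ContinuousLinearMap.adjoint_adjoint, ContinuousLinearMap.comp_assoc]

/-- Each property is transported through `V`, except self-adjointness, which is recovered from
symmetry and the transported resolvent. -/
lemma IsSpectralTriple.conj {A : Type*} [CStarAlgebra A] {ρ : A →⋆ₐ[ℂ] (K →L[ℂ] K)}
    {L : StarSubalgebra ℂ A} {D : K →ₗ.[ℂ] K} (h : IsSpectralTriple ρ L D) (V : K →L[ℂ] K')
    (h₁ : (ContinuousLinearMap.adjoint V).comp V = ContinuousLinearMap.id ℂ K)
    (h₂ : V.comp (ContinuousLinearMap.adjoint V) = ContinuousLinearMap.id ℂ K') :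
    IsSpectralTriple (conjRep V h₁ h₂ ρ) L (conjOp V D) := by
  set W := ContinuousLinearMap.adjoint V with hW
  have hWr : ∀ ξ η, inner ℂ (V ξ) η = inner ℂ ξ (W η) := fun ξ η =>
    (ContinuousLinearMap.adjoint_inner_right V ξ η).symm
  have hWl : ∀ ξ η, inner ℂ (W η) ξ = inner ℂ η (V ξ) := fun ξ η =>
    ContinuousLinearMap.adjoint_inner_left V ξ η
  have hWV : ∀ ξ, W (V ξ) = ξ := DFunLike.congr_fun h₁
  have hVW : ∀ η, V (W η) = η := DFunLike.congr_fun h₂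
  have happ : ∀ η (hη : W η ∈ D.domain) (hη' : η ∈ (conjOp V D).domain),
    conjOp V D ⟨η, hη'⟩ = V (D ⟨W η, hη⟩) := fun _ _ _ => rfl
  have hDV : ∀ ξ (hξ : ξ ∈ D.domain), ∃ hη : V ξ ∈ (conjOp V D).domain,
      conjOp V D ⟨V ξ, hη⟩ = V (D ⟨ξ, hξ⟩) := fun ξ hξ => by
    have h3 : W (V ξ) ∈ D.domain := by rwa [hWV]
    refine ⟨h3, ?_⟩
    refine (happ _ h3 h3).trans ?_
    congr 3
    exact hWV ξ
  have hnorm : ∀ ξ, ‖V ξ‖ = ‖ξ‖ := fun ξ => by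
    have : inner ℂ (V ξ) (V ξ) = inner ℂ ξ ξ := by
      rw [hWr, hWV]
    rw [norm_eq_sqrt_re_inner (𝕜 := ℂ), this, ← norm_eq_sqrt_re_inner]
  have hnormW : ∀ η, ‖W η‖ = ‖η‖ := fun η => by rw [← hnorm, hVW]
  have hdense : Dense ((conjOp V D).domain : Set K') := by
    have hsurj : Function.Surjective V := fun η => ⟨W η, hVW η⟩
    refine (hsurj.denseRange.dense_image V.continuous h.dense_domain).mono ?_
    rintro _ ⟨ξ, hξ, rfl⟩
    exact (hDV ξ hξ).1
  have hcomp : HasCompactResolvent (conjOp V D) := by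
    intro z hz
    obtain ⟨R, hR, hR1, hR2⟩ := h.compact_resolvent z hz
    refine ⟨V.comp (R.comp W), (hR.comp_clm W).clm_comp V, fun η => ?_, fun η => ?_⟩
    · obtain ⟨h3, h4⟩ := hR1 (W η)
      obtain ⟨h5, h6⟩ := hDV _ h3
      refine ⟨h5, ?_⟩
      calc conjOp V D ⟨V (R (W η)), h5⟩ - z • V (R (W η)) = V (W η) := by
            rw [h6, ← map_smul, ← map_sub, h4]
        _ = η := hVW η
    · obtain ⟨η, hη⟩ := η
      have h3 := hR2 ⟨W η, hη⟩
      calc V (R (W (V (D ⟨W η, hη⟩) - z • η))) = V (W η) := by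
            rw [map_sub, map_smul, hWV, h3]
        _ = η := hVW η
  have hsymm : (conjOp V D).IsFormalAdjoint (conjOp V D) := by
    have h3 : D.IsFormalAdjoint D := by
      have := LinearPMap.adjoint_isFormalAdjoint h.dense_domain
      rwa [LinearPMap.isSelfAdjoint_def.1 h.selfAdjoint] at this
    rintro ⟨η, hη⟩ ⟨η', hη'⟩
    have h4 := h3 ⟨W η, hη⟩ ⟨W η', hη'⟩
    exact (hWr _ η').trans (h4.trans (hWl _ η))
  refine ⟨?_, h.dense, hdense, isSelfAdjoint_of_hasCompactResolvent hdense hsymm hcomp, hcomp, ?_⟩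
  · intro a a' haa
    refine h.faithful (ContinuousLinearMap.ext fun ξ => ?_)
    have h3 : V (ρ a (W (V ξ))) = V (ρ a' (W (V ξ))) := DFunLike.congr_fun haa (V ξ)
    rw [hWV] at h3
    rw [← hWV (ρ a ξ), h3, hWV]
  · intro a ha
    obtain ⟨C, hC⟩ := h.bounded_commutator a ha
    refine ⟨C, ?_⟩
    rintro ⟨η, hη⟩
    obtain ⟨h3, h4⟩ := hC ⟨W η, hη⟩
    obtain ⟨h5, h6⟩ := hDV _ h3
    refine ⟨h5, ?_⟩
    calc ‖conjOp V D ⟨V (ρ a (W η)), h5⟩ - V (ρ a (W (V (D ⟨W η, hη⟩))))‖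
        = ‖D ⟨ρ a (W η), h3⟩ - ρ a (D ⟨W η, hη⟩)‖ := by rw [h6, hWV, ← map_sub, hnorm]
      _ ≤ C * ‖W η‖ := h4
      _ = C * ‖η‖ := by rw [hnormW]

end Conjugation

/-! ### The symbol of the Dirac operator. -/

section Symbol

variable {p : ℕ} (B : Matrix (Fin p) (Fin p) ℤ) [hB : Fact (1 < |B.det|)] (n : ℕ)
  (ε : Fin p → Matrix (Fin (2 ^ (p / 2))) (Fin (2 ^ (p / 2))) ℂ)

/-- The Fourier coefficient of a spinor. -/
def coef (z : dualLattice B n) (ξ : Spinors B n) : Fin (2 ^ (p / 2)) → ℂ :=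
  fun l => inner ℂ (fourierBasis B n z) (ξ l)

/-- The symbol `2 π ∑ a, z_a ε^a` of the Dirac operator. -/
def symbol (z : Fin p → ℝ) : Matrix (Fin (2 ^ (p / 2))) (Fin (2 ^ (p / 2))) ℂ :=
  ∑ a, (2 * Real.pi * z a : ℂ) • ε a

lemma coef_add (z : dualLattice B n) (ξ η : Spinors B n) :
    coef B n z (ξ + η) = coef B n z ξ + coef B n z η := by
  ext l
  simp [coef, inner_add_right]

lemma coef_sub (z : dualLattice B n) (ξ η : Spinors B n) :
    coef B n z (ξ - η) = coef B n z ξ - coef B n z η := by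
  ext l
  simp [coef, inner_sub_right]

lemma coef_smul (z : dualLattice B n) (c : ℂ) (ξ : Spinors B n) :
    coef B n z (c • ξ) = c • coef B n z ξ := by
  ext l
  simp [coef, inner_smul_right]

lemma coef_sum {ι : Type*} (s : Finset ι) (z : dualLattice B n) (ξ : ι → Spinors B n) :
    coef B n z (∑ i ∈ s, ξ i) = ∑ i ∈ s, coef B n z (ξ i) := by
  ext l
  simp [coef, inner_sum]

lemma coef_ext {ξ η : Spinors B n} (h : ∀ z, coef B n z ξ = coef B n z η) : ξ = η :=
  amp_ext_inner (fourierBasis B n) fun z l => congrFun (h z) l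

lemma coef_opTensor {ν : dualLattice B n → ℂ} {T : L2 B n →L[ℂ] L2 B n}
    (hT : IsDiag (fourierBasis B n) ν T)
    (M : Matrix (Fin (2 ^ (p / 2))) (Fin (2 ^ (p / 2))) ℂ) (z : dualLattice B n)
    (ξ : Spinors B n) : coef B n z (opTensor T M ξ) = ν z • M.mulVec (coef B n z ξ) := by
  ext l
  simp only [coef, opTensor_apply, inner_sum, inner_smul_right, hT z, Pi.smul_apply,
    Matrix.mulVec, dotProduct, smul_eq_mul, Finset.mul_sum]
  exact Finset.sum_congr rfl fun m _ => by ring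

lemma isDiag_id : IsDiag (fourierBasis B n) (fun _ => 1) (ContinuousLinearMap.id ℂ (L2 B n)) :=
  fun _ _ => (one_mul _).symm

lemma coef_dirac (ξ : Spinors B n) (hξ : ξ ∈ (dirac B ε n).domain) (z : dualLattice B n) :
    coef B n z (dirac B ε n ⟨ξ, hξ⟩) = (symbol ε z).mulVec (coef B n z ξ) := by
  obtain ⟨ζ, hζ, hD⟩ := exists_weakPartials B n ε hξ
  have h : ∀ a, coef B n z (ζ a) = (2 * Real.pi * Complex.I * (z.1 a : ℂ)) • coef B n z ξ :=
    fun a => funext fun l => inner_fourierBasis_of_mem_weakPartialGraph B (hζ a l) z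
  rw [hD, coef_smul, coef_sum, symbol, Matrix.sum_mulVec, Finset.smul_sum]
  refine Finset.sum_congr rfl fun a _ => ?_
  rw [cliffordMul, coef_opTensor B n (isDiag_id B n), h, one_smul, Matrix.mulVec_smul, smul_smul,
    Matrix.smul_mulVec]
  congr 1
  linear_combination (-2 * Real.pi * (z.1 a : ℂ)) * Complex.I_sq

lemma hasSum_star_coef_dotProduct (ξ η : Spinors B n) :
    HasSum (fun z => star (coef B n z ξ) ⬝ᵥ coef B n z η) (inner ℂ ξ η) := by
  rw [PiLp.inner_apply]
  refine hasSum_sum fun l _ => ?_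
  convert! (fourierBasis B n).hasSum_inner_mul_inner (ξ l) (η l) using 2 with z
  simp only [coef, Pi.star_apply]
  rw [← inner_conj_symm (ξ l)]
  rfl

variable {ε}

lemma IsClifford.isHermitian_symbol (hε : IsClifford ε) (z : Fin p → ℝ) :
    (symbol ε z).IsHermitian := by
  rw [Matrix.IsHermitian, symbol, Matrix.conjTranspose_sum]
  refine Finset.sum_congr rfl fun a _ => ?_
  rw [Matrix.conjTranspose_smul, (hε.1 a).eq]
  congr 1
  simp

/-- The square `4 π² |z|²` of the symbol of the Dirac operator. -/
def symbolSq (z : Fin p → ℝ) : ℝ := ∑ a, (2 * Real.pi * z a) ^ 2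

/-- Adding the double sum to its copy with `a` and `b` exchanged produces anticommutators, so only
the diagonal terms survive. This proves twice the identity, and the factor `2` is cancelled at the
end. -/
lemma IsClifford.symbol_mul_symbol (hε : IsClifford ε) (z : Fin p → ℝ) :
    symbol ε z * symbol ε z = (symbolSq z : ℂ) • 1 := by
  have h1 : symbol ε z * symbol ε z =
      ∑ a, ∑ b, ((2 * Real.pi * z a : ℂ) * (2 * Real.pi * z b)) • (ε a * ε b) := by
    simp only [symbol, Finset.sum_mul_sum, smul_mul_smul_comm]
  have h2 : symbol ε z * symbol ε z =
      ∑ a, ∑ b, ((2 * Real.pi * z a : ℂ) * (2 * Real.pi * z b)) • (ε b * ε a) := by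
    rw [h1, Finset.sum_comm]
    simp only [mul_comm]
  have h3 : (2 : ℂ) • (symbol ε z * symbol ε z) = (2 : ℂ) • ((symbolSq z : ℂ) • 1) := by
    rw [two_smul]
    nth_rw 1 [h1]
    rw [h2]
    simp only [← Finset.sum_add_distrib, ← smul_add, hε.2, smul_ite, smul_zero,
      Finset.sum_ite_eq, Finset.mem_univ, if_true]
    have h4 : (2 : Matrix (Fin (2 ^ (p / 2))) (Fin (2 ^ (p / 2))) ℂ) = (2 : ℂ) • 1 := by
      rw [two_smul, one_add_one_eq_two]
    have h5 : (symbolSq z : ℂ) = ∑ a, (2 * Real.pi * z a : ℂ) * (2 * Real.pi * z a) := by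
      simp [symbolSq, sq]
    rw [← Finset.sum_smul, h4, h5, smul_comm]
  exact smul_right_injective _ two_ne_zero h3

lemma sq_le_symbolSq (z : Fin p → ℝ) (a : Fin p) : (2 * Real.pi * z a) ^ 2 ≤ symbolSq z :=
  Finset.single_le_sum (f := fun a => (2 * Real.pi * z a) ^ 2) (fun _ _ => sq_nonneg _)
    (Finset.mem_univ a)

lemma symbolSq_nonneg (z : Fin p → ℝ) : 0 ≤ symbolSq z := Finset.sum_nonneg fun _ _ => sq_nonneg _

/-- A bound on the symbol bounds `z`, hence the integer vector `w = A^{-n} z`; only finitely many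
such `w` exist. -/
lemma tendsto_symbolSq :
    Filter.Tendsto (fun z : dualLattice B n => symbolSq z.1) Filter.cofinite Filter.atTop := by
  refine Filter.tendsto_atTop.2 fun C => Filter.eventually_cofinite.2 ?_
  have hu : IsUnit (dualMat B ^ n).det :=
    (Matrix.isUnit_iff_isUnit_det _).1
      (Matrix.mulVec_injective_iff_isUnit.1 (dualMat_pow_mulVec_injective B n))
  let L : (Fin p → ℝ) →L[ℝ] (Fin p → ℝ) :=
    LinearMap.toContinuousLinearMap (dualMat B ^ n)⁻¹.mulVecLin
  let m : ℤ := ⌈‖L‖ * (1 + |C|)⌉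
  let g : (Fin p → ℤ) → dualLattice B n := fun w =>
    ⟨(dualMat B ^ n).mulVec fun a => (w a : ℝ), mem_imgLattice.2 ⟨w, rfl⟩⟩
  refine ((Set.finite_Icc (fun _ => -m) (fun _ => m)).image g).subset fun z hz => ?_
  obtain ⟨w, hw⟩ := mem_imgLattice.1 z.2
  -- Each coordinate satisfies `z_a² ≤ (2π z_a)² < C ≤ (1 + |C|)²`.
  have hz' : ‖z.1‖ ≤ 1 + |C| := by
    refine (pi_norm_le_iff_of_nonneg (by positivity)).2 fun a => ?_
    have h1 : (2 * Real.pi * z.1 a) ^ 2 < C := (sq_le_symbolSq z.1 a).trans_lt (not_le.1 hz)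
    have h2 : (z.1 a) ^ 2 ≤ (2 * Real.pi * z.1 a) ^ 2 := by
      rw [mul_pow]
      have : (1 : ℝ) ≤ (2 * Real.pi) ^ 2 := by nlinarith [Real.pi_gt_three]
      nlinarith [sq_nonneg (z.1 a)]
    rw [Real.norm_eq_abs]
    refine abs_le_of_sq_le_sq (h2.trans (h1.le.trans ?_)) (by positivity)
    nlinarith [le_abs_self C, abs_nonneg C]
  have hLz : L z.1 = fun a => (w a : ℝ) := by
    change (dualMat B ^ n)⁻¹.mulVec z.1 = _
    rw [hw, Matrix.mulVec_mulVec, Matrix.nonsing_inv_mul _ hu, Matrix.one_mulVec]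
  have hwa : ∀ a, |w a| ≤ m := fun a => by
    have h1 : |(w a : ℝ)| ≤ ‖L‖ * (1 + |C|) := by
      have h2 := (norm_le_pi_norm (L z.1) a).trans ((L.le_opNorm z.1).trans
        (mul_le_mul_of_nonneg_left hz' (norm_nonneg L)))
      rwa [hLz, Real.norm_eq_abs] at h2
    exact_mod_cast h1.trans (Int.le_ceil _)
  exact ⟨w, ⟨fun a => (abs_le.1 (hwa a)).1, fun a => (abs_le.1 (hwa a)).2⟩, Subtype.ext hw.symm⟩

end Symbol

/-! ### Compact resolvent, symmetry and dense domain of the Dirac operator. -/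

section Resolvent

variable {p : ℕ} (B : Matrix (Fin p) (Fin p) ℤ) [hB : Fact (1 < |B.det|)] (n : ℕ)
  {ε : Fin p → Matrix (Fin (2 ^ (p / 2))) (Fin (2 ^ (p / 2))) ℂ}

lemma ofReal_sub_sq_ne_zero {w : ℂ} (hw : w.im ≠ 0) {x : ℝ} (hx : 0 ≤ x) : (x : ℂ) - w ^ 2 ≠ 0 := by
  intro h
  have h1 : (w - (Real.sqrt x : ℂ)) * (w + (Real.sqrt x : ℂ)) = 0 := by
    have : ((Real.sqrt x : ℂ)) ^ 2 = x := by
      rw [← Complex.ofReal_pow, Real.sq_sqrt hx]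
    linear_combination -h - this
  rcases mul_eq_zero.1 h1 with h2 | h2
  · exact hw (by simpa using congrArg Complex.im h2)
  · exact hw (by simpa using congrArg Complex.im h2)

/-- On the bounded interval this is compactness, as `x - w²` has no zero there. For `x > 2|w²| + 1`,
`|x - w²| ≥ x - |w²| > (1 + x) / 2`, so the constant `2` suffices. -/
lemma exists_one_add_le_mul_norm_sub_sq {w : ℂ} (hw : w.im ≠ 0) :
    ∃ C : ℝ, 0 ≤ C ∧ ∀ x : ℝ, 0 ≤ x → 1 + x ≤ C * ‖(x : ℂ) - w ^ 2‖ := by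
  have hcont : ContinuousOn (fun x : ℝ => (1 + x) / ‖(x : ℂ) - w ^ 2‖)
      (Set.Icc 0 (2 * ‖w ^ 2‖ + 1)) := by
    refine ContinuousOn.div (by fun_prop) (by fun_prop) fun x hx => ?_
    exact norm_ne_zero_iff.2 (ofReal_sub_sq_ne_zero hw hx.1)
  obtain ⟨C, hC⟩ := isCompact_Icc.exists_bound_of_continuousOn hcont
  refine ⟨max C 2, by positivity, fun x hx => ?_⟩
  by_cases hxb : x ≤ 2 * ‖w ^ 2‖ + 1
  · have h1 := (le_abs_self _).trans (hC x ⟨hx, hxb⟩)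
    have h2 : 0 < ‖(x : ℂ) - w ^ 2‖ := norm_pos_iff.2 (ofReal_sub_sq_ne_zero hw hx)
    rw [div_le_iff₀ h2] at h1
    exact h1.trans (mul_le_mul_of_nonneg_right (le_max_left _ _) h2.le)
  · have h1 : x - ‖w ^ 2‖ ≤ ‖(x : ℂ) - w ^ 2‖ := by
      have := norm_sub_norm_le (x : ℂ) (w ^ 2)
      rwa [Complex.norm_real, Real.norm_of_nonneg hx] at this
    have h2 : 2 * ‖(x : ℂ) - w ^ 2‖ ≤ max C 2 * ‖(x : ℂ) - w ^ 2‖ :=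
      mul_le_mul_of_nonneg_right (le_max_right _ _) (norm_nonneg _)
    linarith

/-- Boundedness of `2πi z_a ν_z` makes these numbers the eigenvalues of a bounded diagonal operator,
which is `∂^a T`. -/
lemma IsDiag.mem_weakPartial_domain {ν : dualLattice B n → ℂ} {T : L2 B n →L[ℂ] L2 B n}
    (hT : IsDiag (fourierBasis B n) ν T) {a : Fin p} {C : ℝ}
    (hC : ∀ z : dualLattice B n, ‖2 * Real.pi * Complex.I * (z.1 a : ℂ) * ν z‖ ≤ C) (ξ : L2 B n) :
    T ξ ∈ (weakPartial B n a).domain := by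
  obtain ⟨S, hS⟩ := exists_isDiag (fourierBasis B n) hC
  refine (exists_weakPartial_eq B ((mem_weakPartialGraph_iff B (η := S ξ)).2 fun z => ?_)).1
  rw [hS, hT, mul_assoc]

lemma opTensor_mem_weakPartial_domain {ν : dualLattice B n → ℂ} {T : L2 B n →L[ℂ] L2 B n}
    (hT : IsDiag (fourierBasis B n) ν T) {a : Fin p} {C : ℝ}
    (hC : ∀ z : dualLattice B n, ‖2 * Real.pi * Complex.I * (z.1 a : ℂ) * ν z‖ ≤ C)
    (M : Matrix (Fin (2 ^ (p / 2))) (Fin (2 ^ (p / 2))) ℂ) (ξ : Spinors B n)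
    (l : Fin (2 ^ (p / 2))) : opTensor T M ξ l ∈ (weakPartial B n a).domain := by
  rw [opTensor_apply]
  exact Submodule.sum_mem _ fun m _ => Submodule.smul_mem _ _
    (hT.mem_weakPartial_domain B n hC (ξ m))

/-- The Dirac operator on `T_n` has compact resolvent. -/
lemma hasCompactResolvent_dirac (hε : IsClifford ε) : HasCompactResolvent (dirac B ε n) := by
  intro w hw
  obtain ⟨C, hC0, hC⟩ := exists_one_add_le_mul_norm_sub_sq hw
  set den : dualLattice B n → ℂ := fun z => (symbolSq z.1 : ℂ) - w ^ 2 with hden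
  have hden0 : ∀ z, den z ≠ 0 := fun z => ofReal_sub_sq_ne_zero hw (symbolSq_nonneg _)
  have hsymbolSq := fun z : dualLattice B n => symbolSq_nonneg z.1
  have hbound : ∀ (z : dualLattice B n) (c : ℂ), ‖c‖ ≤ 1 + symbolSq z.1 → ‖c * (den z)⁻¹‖ ≤ C :=
    fun z c hc => by
      rw [norm_mul, norm_inv, ← div_eq_mul_inv, div_le_iff₀ (norm_pos_iff.2 (hden0 z))]
      exact hc.trans (hC _ (hsymbolSq z))
  -- A numerator of size at most `√(1 + 4π²|z|²)` over a denominator of order `1 + 4π²|z|²` tends to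
  -- zero: the source of compactness.
  have hto : ∀ c : dualLattice B n → ℂ, (∀ z, ‖c z‖ ^ 2 ≤ 1 + symbolSq z.1) →
      Filter.Tendsto (fun z => c z * (den z)⁻¹) Filter.cofinite (nhds 0) := fun c hc => by
    have h1 : Filter.Tendsto (fun z : dualLattice B n => C * (Real.sqrt (1 + symbolSq z.1))⁻¹)
        Filter.cofinite (nhds 0) := by
      rw [← mul_zero C]
      exact (Filter.Tendsto.inv_tendsto_atTop (Real.tendsto_sqrt_atTop.comp
        (Filter.tendsto_atTop_add_const_left _ 1 (tendsto_symbolSq B n)))).const_mul C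
    refine squeeze_zero_norm (fun z => ?_) h1
    have h2 : 0 < 1 + symbolSq z.1 := by linarith [hsymbolSq z]
    have h3 : ‖c z‖ ≤ Real.sqrt (1 + symbolSq z.1) := Real.le_sqrt_of_sq_le (hc z)
    rw [norm_mul, norm_inv, ← div_eq_mul_inv, ← div_eq_mul_inv,
      div_le_div_iff₀ (norm_pos_iff.2 (hden0 z)) (Real.sqrt_pos.2 h2)]
    calc ‖c z‖ * Real.sqrt (1 + symbolSq z.1)
        ≤ Real.sqrt (1 + symbolSq z.1) * Real.sqrt (1 + symbolSq z.1) := by gcongr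
      _ = 1 + symbolSq z.1 := Real.mul_self_sqrt h2.le
      _ ≤ C * ‖den z‖ := hC _ (hsymbolSq z)
  have hnorm : ∀ (z : dualLattice B n) a, ‖(2 * Real.pi * z.1 a : ℂ)‖ ^ 2 ≤ symbolSq z.1 :=
    fun z a => by
      have : ‖(2 * Real.pi * z.1 a : ℂ)‖ = |2 * Real.pi * z.1 a| := by
        rw [← Real.norm_eq_abs, ← Complex.norm_real]
        push_cast
        rfl
      rw [this, sq_abs]
      exact sq_le_symbolSq z.1 a
  have hnorm' : ∀ (z : dualLattice B n) a,
      ‖(2 * Real.pi * Complex.I * z.1 a : ℂ)‖ = ‖(2 * Real.pi * z.1 a : ℂ)‖ := fun z a => by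
    rw [mul_right_comm, norm_mul, Complex.norm_I, mul_one]
  have hlin : ∀ (z : dualLattice B n) a, ‖(2 * Real.pi * z.1 a : ℂ)‖ ≤ 1 + symbolSq z.1 :=
    fun z a => by nlinarith [hnorm z a, sq_nonneg (‖(2 * Real.pi * z.1 a : ℂ)‖ - 1)]
  choose T hT using fun a : Fin p => exists_isDiag (fourierBasis B n)
    (fun z => hbound z (2 * Real.pi * z.1 a) (hlin z a))
  obtain ⟨T₁, hT₁⟩ := exists_isDiag (fourierBasis B n)
    (fun z => hbound z 1 (by simpa using hsymbolSq z))
  -- This is `(D + w)(D² - w²)⁻¹`: `T a` has eigenvalues `2π z_a / den z` and `T₁` has `1 / den z`.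
  let R : Spinors B n →L[ℂ] Spinors B n := ∑ a, opTensor (T a) (ε a) + w • opTensor T₁ 1
  have hRapply : ∀ ξ, R ξ = ∑ a, opTensor (T a) (ε a) ξ + w • opTensor T₁ 1 ξ := fun ξ => by
    simp [R]
  have hcoef : ∀ z ξ, coef B n z (R ξ) =
      (den z)⁻¹ • (symbol ε z.1 + w • 1).mulVec (coef B n z ξ) := fun z ξ => by
    rw [hRapply, coef_add, coef_smul, coef_sum, coef_opTensor B n hT₁, Matrix.add_mulVec, smul_add,
      Matrix.smul_mulVec, symbol, Matrix.sum_mulVec, Finset.smul_sum]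
    congr 1
    · refine Finset.sum_congr rfl fun a _ => ?_
      rw [coef_opTensor B n (hT a), Matrix.smul_mulVec, smul_smul, mul_comm]
    · rw [smul_smul, smul_smul, one_mul, mul_comm]
  have hsym : ∀ z (v : Fin (2 ^ (p / 2)) → ℂ),
      (symbol ε z).mulVec ((symbol ε z).mulVec v) = (symbolSq z : ℂ) • v := fun z v => by
    rw [Matrix.mulVec_mulVec, hε.symbol_mul_symbol, Matrix.smul_mulVec, Matrix.one_mulVec]
  refine ⟨R, ?_, fun ξ => ?_, ?_⟩
  · refine Submodule.add_mem (compactOperator (RingHom.id ℂ) (Spinors B n) (Spinors B n))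
      (Submodule.sum_mem _ fun a _ => ?_) (Submodule.smul_mem _ _ ?_)
    · refine isCompactOperator_opTensor ((hT a).isCompactOperator (hto _ fun z => ?_)) _
      linarith [hnorm z a]
    · refine isCompactOperator_opTensor (hT₁.isCompactOperator (hto _ fun z => ?_)) _
      simpa using hsymbolSq z
  · have hdom : R ξ ∈ (dirac B ε n).domain := by
      refine (mem_dirac_domain B n ε).2 fun b l => ?_
      rw [hRapply]
      simp only [PiLp.add_apply, PiLp.smul_apply, WithLp.ofLp_sum, Finset.sum_apply]
      refine Submodule.add_mem _ (Submodule.sum_mem _ fun a _ => ?_) (Submodule.smul_mem _ _ ?_)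
      · refine opTensor_mem_weakPartial_domain B n (hT a) (fun z => ?_) _ _ _ (C := C)
        rw [← mul_assoc]
        refine hbound z _ ?_
        rw [norm_mul, hnorm']
        -- The product of two coordinates is at most half the sum of their squares, hence at most
        -- `symbolSq`.
        nlinarith [hnorm z a, hnorm z b,
          sq_nonneg (‖(2 * Real.pi * z.1 b : ℂ)‖ - ‖(2 * Real.pi * z.1 a : ℂ)‖)]
      · refine opTensor_mem_weakPartial_domain B n hT₁ (fun z => ?_) _ _ _ (C := C)
        rw [← mul_assoc, mul_one]
        refine hbound z _ ?_
        rw [hnorm']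
        exact hlin z b
    refine ⟨hdom, coef_ext B n fun z => ?_⟩
    rw [coef_sub, coef_smul, coef_dirac, hcoef, Matrix.mulVec_smul, Matrix.add_mulVec,
      Matrix.mulVec_add, hsym, Matrix.smul_mulVec, Matrix.one_mulVec, Matrix.mulVec_smul,
      smul_comm w, ← smul_sub, inv_smul_eq_iff₀ (hden0 z), smul_add, add_sub_add_comm, smul_smul]
    simp only [hden, sub_smul, sq]
    abel
  · rintro ⟨ξ, hξ⟩
    refine coef_ext B n fun z => ?_
    rw [hcoef, coef_sub, coef_smul, coef_dirac, inv_smul_eq_iff₀ (hden0 z), Matrix.add_mulVec,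
      Matrix.mulVec_sub, hsym, Matrix.smul_mulVec, Matrix.one_mulVec, Matrix.mulVec_smul, smul_sub,
      smul_smul]
    simp only [hden, sub_smul, sq]
    abel

/-- On Fourier coefficients the operator multiplies by a Hermitian matrix, and Parseval's formula
transfers the symmetry. -/
lemma isFormalAdjoint_dirac (hε : IsClifford ε) :
    (dirac B ε n).IsFormalAdjoint (dirac B ε n) := by
  rintro ⟨ξ, hξ⟩ ⟨η, hη⟩
  refine (hasSum_star_coef_dotProduct B n _ _).unique
    ((hasSum_star_coef_dotProduct B n _ _).congr_fun fun z => ?_)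
  rw [coef_dirac, coef_dirac, Matrix.star_mulVec, (hε.isHermitian_symbol _).eq,
    ← Matrix.dotProduct_mulVec]

/-- The domain contains every character placed in a single spinor component, and these have trivial
orthogonal complement. -/
lemma dense_dirac_domain : Dense ((dirac B ε n).domain : Set (Spinors B n)) := by
  rw [Submodule.dense_iff_topologicalClosure_eq_top, Submodule.topologicalClosure_eq_top_iff,
    Submodule.eq_bot_iff]
  intro ξ hξ
  refine amp_ext_inner (fourierBasis B n) fun z l => ?_
  have h := (Submodule.mem_orthogonal _ _).1 hξ
    (WithLp.toLp 2 (Pi.single l (fourierBasis B n z))) ((mem_dirac_domain B n ε).2 fun a m => ?_)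
  · rw [inner_toLp_single] at h
    simpa using h
  · by_cases hm : m = l
    · subst hm
      refine (exists_weakPartial_eq B ((mem_weakPartialGraph_iff B
        (η := (2 * Real.pi * Complex.I * (z.1 a : ℂ)) • fourierBasis B n z)).2 fun y => ?_)).1
      classical
      simp only [Pi.single_eq_same, inner_smul_right,
        orthonormal_iff_ite.1 (fourierBasis B n).orthonormal]
      split_ifs with hy
      · rw [hy]
      · simp
    · simp [hm]

end Resolvent

/-! ### The spectral triple of the torus. -/

section SpectralTriple

variable {p : ℕ} (B : Matrix (Fin p) (Fin p) ℤ) [hB : Fact (1 < |B.det|)] (n : ℕ)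
  {ε : Fin p → Matrix (Fin (2 ^ (p / 2))) (Fin (2 ^ (p / 2))) ℂ}

lemma spinorMul_apply (f : C(Torus B n, ℂ)) (ξ : Spinors B n) (l : Fin (2 ^ (p / 2))) :
    spinorMul B n f ξ l = mulOp B n f (ξ l) := by
  simp [spinorMul, opTensor_apply, Matrix.one_apply]

lemma mulOp_one (ξ : L2 B n) : mulOp B n 1 ξ = ξ := by
  apply Lp.ext
  filter_upwards [coeFn_mulOp B n 1 ξ] with t h
  rw [h, ContinuousMap.one_apply, one_mul]

lemma mulOp_mul (f g : C(Torus B n, ℂ)) (ξ : L2 B n) :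
    mulOp B n (f * g) ξ = mulOp B n f (mulOp B n g ξ) := by
  apply Lp.ext
  filter_upwards [coeFn_mulOp B n (f * g) ξ, coeFn_mulOp B n f (mulOp B n g ξ),
    coeFn_mulOp B n g ξ] with t h1 h2 h3
  rw [h1, h2, h3, ContinuousMap.mul_apply, mul_assoc]

lemma mulOp_add (f g : C(Torus B n, ℂ)) (ξ : L2 B n) :
    mulOp B n (f + g) ξ = mulOp B n f ξ + mulOp B n g ξ := by
  simp [mulOp]

lemma mulOp_smul (c : ℂ) (f : C(Torus B n, ℂ)) (ξ : L2 B n) :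
    mulOp B n (c • f) ξ = c • mulOp B n f ξ := by
  simp [mulOp]

/-- The representation of `C(T_n)` on the spinors by multiplication operators. -/
def spinorRep : C(Torus B n, ℂ) →⋆ₐ[ℂ] (Spinors B n →L[ℂ] Spinors B n) where
  toFun f := spinorMul B n f
  map_one' := by
    ext1 ξ
    ext l : 1
    rw [spinorMul_apply, mulOp_one]
    rfl
  map_mul' f g := by
    ext1 ξ
    ext l : 1
    rw [spinorMul_apply, mulOp_mul, ← spinorMul_apply, ← spinorMul_apply]
    rfl
  map_zero' := by
    ext1 ξ
    ext l : 1
    rw [spinorMul_apply, ← zero_smul ℂ (0 : C(Torus B n, ℂ)), mulOp_smul, zero_smul]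
    rfl
  map_add' f g := by
    ext1 ξ
    ext l : 1
    rw [spinorMul_apply, mulOp_add, ← spinorMul_apply, ← spinorMul_apply]
    rfl
  commutes' c := by
    ext1 ξ
    ext l : 1
    rw [spinorMul_apply, Algebra.algebraMap_eq_smul_one, mulOp_smul, mulOp_one,
      Algebra.algebraMap_eq_smul_one]
    rfl
  map_star' f := by
    rw [ContinuousLinearMap.star_eq_adjoint, ContinuousLinearMap.eq_adjoint_iff]
    intro ξ η
    rw [PiLp.inner_apply, PiLp.inner_apply]
    refine Finset.sum_congr rfl fun l _ => ?_
    rw [spinorMul_apply, spinorMul_apply, inner_mulOp]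

lemma spinorRep_apply (f : C(Torus B n, ℂ)) : spinorRep B n f = spinorMul B n f := rfl

lemma spinorRep_injective : Function.Injective (spinorRep B n) := by
  intro f g h
  let l : Fin (2 ^ (p / 2)) := ⟨0, by positivity⟩
  -- Applying the operator to the constant spinor `1` recovers `f` as an element of `L²`, which
  -- determines a continuous `f`.
  have h1 := congrArg (fun ξ : Spinors B n => ξ l) (DFunLike.congr_fun h
    (WithLp.toLp 2 fun _ => toL2 B n 1))
  simp only [spinorRep_apply, spinorMul_apply, mulOp_toL2, mul_one] at h1
  exact ContinuousMap.toLp_injective (haar B n) h1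

lemma dense_C1 : Dense (C1 B n : Set C(Torus B n, ℂ)) := by
  have h : charSubalgebra B n ≤ C1 B n := by
    change Algebra.adjoin ℂ (Set.range (char B n)) ≤ (C1 B n).toSubalgebra
    refine Algebra.adjoin_le ?_
    rintro _ ⟨z, rfl⟩
    exact isOfClass_char 1 z
  refine Dense.mono (s₁ := (charSubalgebra B n : Set C(Torus B n, ℂ))) h ?_
  rw [dense_iff_closure_eq, ← StarSubalgebra.topologicalClosure_coe, charSubalgebra_closure]
  rfl

lemma cliffordMul_spinorMul (M : Matrix (Fin (2 ^ (p / 2))) (Fin (2 ^ (p / 2))) ℂ)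
    (f : C(Torus B n, ℂ)) (ξ : Spinors B n) :
    cliffordMul B n M (spinorMul B n f ξ) = spinorMul B n f (cliffordMul B n M ξ) := by
  ext l : 1
  simp only [cliffordMul_apply, spinorMul_apply, map_sum, map_smul]

lemma bounded_commutator_dirac {f : C(Torus B n, ℂ)} (hf : IsOfClass B 1 f) :
    ∃ C : ℝ, ∀ ξ : (dirac B ε n).domain, ∃ h : spinorMul B n f ξ ∈ (dirac B ε n).domain,
      ‖dirac B ε n ⟨spinorMul B n f ξ, h⟩ - spinorMul B n f (dirac B ε n ξ)‖ ≤
        C * ‖(ξ : Spinors B n)‖ := by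
  choose f' hf' using fun a => hf.exists_isPartial a
  -- By the Leibniz rule the commutator is `-i ∑ a, ε^a ⊗ ∂^a f`, bounded because each `∂^a f` is
  -- continuous on a compact space.
  let T : Spinors B n →L[ℂ] Spinors B n :=
    (-Complex.I) • ∑ a, (cliffordMul B n (ε a)).comp (spinorMul B n (f' a))
  refine ⟨‖T‖, ?_⟩
  rintro ⟨ξ, hξ⟩
  obtain ⟨ζ, hζ, hD⟩ := exists_weakPartials B n ε hξ
  obtain ⟨h, h'⟩ := exists_dirac_eq B n ε (ξ := spinorMul B n f ξ)
    (ζ := fun a => spinorMul B n f (ζ a) + spinorMul B n (f' a) ξ) fun a l => by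
      rw [PiLp.add_apply, spinorMul_apply, spinorMul_apply, spinorMul_apply]
      exact mulOp_mem_weakPartialGraph B (hf' a) (hζ a l)
  refine ⟨h, ?_⟩
  have hT : dirac B ε n ⟨spinorMul B n f ξ, h⟩ - spinorMul B n f (dirac B ε n ⟨ξ, hξ⟩) = T ξ := by
    rw [h', hD, map_smul, ← smul_sub, map_sum, ← Finset.sum_sub_distrib]
    simp [T, cliffordMul_spinorMul]
  rw [hT]
  exact T.le_opNorm ξ

/-- The spectral triple of the torus `T_n`. -/
lemma isSpectralTriple_dirac (hε : IsClifford ε) :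
    IsSpectralTriple (spinorRep B n) (C1 B n) (dirac B ε n) where
  faithful := spinorRep_injective B n
  dense := dense_C1 B n
  dense_domain := dense_dirac_domain B n
  selfAdjoint := isSelfAdjoint_of_hasCompactResolvent (dense_dirac_domain B n)
    (isFormalAdjoint_dirac B n hε) (hasCompactResolvent_dirac B n hε)
  compact_resolvent := hasCompactResolvent_dirac B n hε
  bounded_commutator := fun _ hf => bounded_commutator_dirac B n hf

end SpectralTriple

end TorusCover

end

theorem mainTheorem10 {p : ℕ} (B : Matrix (Fin p) (Fin p) ℤ) [Fact (1 < |B.det|)]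
    (ε : Fin p → Matrix (Fin (2 ^ (p / 2))) (Fin (2 ^ (p / 2))) ℂ) (hε : IsClifford ε) (n : ℕ) :
    -- the index set of the matrices has `r = |det B|` elements
    (Fintype.card (ZBdual B) : ℤ) = |B.det| ∧
    -- the components of `v_{m+1} ξ` are the functions `σ(k)⁻¹ E_k(ξ)`
    (∀ (m : ℕ) (ξ : L2 B (m + 1)) (k : ZBdual B),
      pull B m (coverStep B m ξ k) = mulOp B (m + 1) (star (sigma B m k)) (eigenProj B m k ξ)) ∧
    -- `V_n` is unitary
    (ContinuousLinearMap.adjoint (coverV B n)).comp (coverV B n) = ContinuousLinearMap.id ℂ _ ∧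
    (coverV B n).comp (ContinuousLinearMap.adjoint (coverV B n)) = ContinuousLinearMap.id ℂ _ ∧
    -- the formula for `V_n D_n V_n*`
    diracHat B ε n = amplify (Fin n → ZBdual B) (dirac B ε 0) -
      ((2 * Real.pi : ℂ) • (sectionOp B ε n).toLinearMap).toPMap ⊤ ∧
    -- the spectral triple
    ∃ π : C(Torus B n, ℂ) →⋆ₐ[ℂ] (BaseSpinors B n →L[ℂ] BaseSpinors B n),
      (∀ f, π f = (coverV B n).comp
        ((spinorMul B n f).comp (ContinuousLinearMap.adjoint (coverV B n)))) ∧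
      IsSpectralTriple π (C1 B n) (diracHat B ε n) :=
  ⟨card_ZBdual B, pull_coverStep B, coverV_adjoint_comp B n, coverV_comp_adjoint B n,
    diracHat_eq B n ε, conjRep (coverV B n) (coverV_adjoint_comp B n) (coverV_comp_adjoint B n)
      (spinorRep B n), fun _ => rfl,
    (isSpectralTriple_dirac B n hε).conj (coverV B n) (coverV_adjoint_comp B n)
      (coverV_comp_adjoint B n)⟩
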